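/- Fix a commutative ring $R$. Directed graphs may have loops but no parallel edges and may be infinite; a map $X\to Y$ of directed graphs is a function $f$ on vertices such that for every edge $x\to y$ of $X$ either $f(x)=f(y)$ or $f(x)\to f(y)$ is an edge of $Y$. Let $d(x,y)\in\mathbb{N}\cup\{\infty\}$ be the minimal number of edges in a directed path from $x$ to $y$. The reachability chain complex $\mathrm{RC}_*(X)$ is free over $R$ in degree $k$ on the tuples $(x_0,\dots,x_k)$ of vertices with $x_{i}\neq x_{i+1}$ and $d(x_i,x_{i+1})<\infty$ for all $i$, with $\partial(x_0,\dots,x_k)=\sum_i(-1)^i(x_0,\dots,\widehat{x_i},\dots,x_k)$, where terms with repeated consecutive entries are omitted. It is filtered by the subcomplexes $F_p\mathrm{RC}_*(X)$ spanned by the tuples of length $\sum_i d(x_i,x_{i+1})\le p$. Let $E^r_{i,j}(X)$ ($i$ the filtration degree, $i+j$ the total degree) be the spectral sequence of this filtered complex, and let $\mathrm{PH}_{k,\ell}(X)=E^2_{\ell,k-\ell}(X)$ be the bigraded path homology of $X$, a functor on directed graphs. It vanishes if $k<0$ or $\ell<0$. Let $\bullet$ be the directed graph with one vertex. The suspension $SX$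 of $X$ is obtained by adding two new vertices $\pm1$ together with an edge from each of the new vertices to each vertex of $X$. **Theorem.** (a) For nonempty directed graphs $X$ and $k,\ell\ge 0$ there is an isomorphism of $R$-modules, natural in $X$ with respect to maps of directed graphs, $$\ker\bigl(\mathrm{PH}_{k,\ell}(SX)\to\mathrm{PH}_{k,\ell}(\bullet)\bigr)\cong\ker\bigl(\mathrm{PH}_{k-1,\ell-1}(X)\to\mathrm{PH}_{k-1,\ell-1}(\bullet)\bigr).$$ (b) In particular, for $k,\ell\ge0$ with $(k,\ell)\neq(0,0),(1,1)$, there is an isomorphism $\mathrm{PH}_{k,\ell}(SX)\cong\mathrm{PH}_{k-1,\ell-1}(X)$ natural in nonempty $X$, and in the two exceptional bidegrees the groups differ by a single summand $R$: for each nonempty $X$, $\mathrm{PH}_{0,0}(SX)\cong\mathrm{PH}_{-1,-1}(X)\oplus R$ and $\mathrm{PH}_{0,0}(X)\cong\mathrm{PH}_{1,1}(SX)\oplus R$. (c) For $n\ge0$ let $\mathbb{S}^n=S^{n+1}\emptyset$ be the $(n+1)$-fold suspension of the empty graph. Then $\ker\bigl(\mathrm{PH}_{k,\ell}(\mathbb{S}^n)\to\mathrm{PH}_{k,\ell}(\bullet)\bigr)$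 is isomorphic to $R$ if $(k,\ell)=(n,n)$ and is $0$ otherwise. Hence $\mathrm{PH}_{k,\ell}(\mathbb{S}^0)$ is isomorphic to $R\oplus R$ if $(k,\ell)=(0,0)$ and is $0$ otherwise; and for $n>0$, $\mathrm{PH}_{k,\ell}(\mathbb{S}^n)$ is isomorphic to $R$ if $(k,\ell)$ is $(0,0)$ or $(n,n)$ and is $0$ otherwise. -/

import Mathlib

universe u v

namespace MagPath

/-- A map of directed graphs: each edge goes to an edge or is collapsed to a vertex. -/
structure DigraphMap {V W : Type*} (X : Digraph V) (Y : Digraph W) where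
  toFun : V → W
  map_adj : ∀ {x y : V}, X.Adj x y → toFun x = toFun y ∨ Y.Adj (toFun x) (toFun y)

/-- The identity map. -/
def DigraphMap.id {V : Type*} (X : Digraph V) : DigraphMap X X where
  toFun := fun x => x
  map_adj := Or.inr

/-- Composition of maps of directed graphs. -/
def DigraphMap.comp {V W U : Type*} {X : Digraph V} {Y : Digraph W} {Z : Digraph U}
    (g : DigraphMap Y Z) (f : DigraphMap X Y) : DigraphMap X Z where
  toFun := fun x => g.toFun (f.toFun x)
  map_adj := by
    intro x y h
    rcases f.map_adj h with h1 | h1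
    · exact Or.inl (congrArg g.toFun h1)
    · exact g.map_adj h1

/-- The directed graph with a unique vertex. -/
def point : Digraph Unit := ⊥

/-- The unique map to the one-vertex graph. -/
def toPoint {V : Type*} (X : Digraph V) : DigraphMap X point where
  toFun := fun _ => ()
  map_adj := fun _ => Or.inl rfl

/-- `HasPath X n x y`: there is a directed path from `x` to `y` with exactly `n` edges
(vertices may repeat). -/
inductive HasPath {V : Type*} (X : Digraph V) : ℕ → V → V → Prop
  | nil (x : V) : HasPath X 0 x x
  | cons {n : ℕ} {x y z : V} : X.Adj x y → HasPath X n y z → HasPath X (n + 1) x z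

/-- There is a directed path from `x` to `y`. -/
def Reachable {V : Type*} (X : Digraph V) (x y : V) : Prop := ∃ n, HasPath X n x y

/-- The shortest path metric: the minimal number of edges in a directed path from `x` to `y`,
or `⊤` if there is none. -/
noncomputable def dist {V : Type*} (X : Digraph V) (x y : V) : ℕ∞ :=
  ⨅ (n : ℕ) (_ : HasPath X n x y), (n : ℕ∞)

/-- The length `d(x₀,x₁) + ⋯ + d(xₖ₋₁,xₖ)` of a tuple `(x₀,…,xₖ)`. -/
noncomputable def len {V : Type*} (X : Digraph V) : List V → ℕ∞
  | [] => 0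
  | [_] => 0
  | x :: y :: l => dist X x y + len X (y :: l)

/-- A nonempty tuple in which consecutive entries are distinct. -/
def Nondeg {V : Type*} (l : List V) : Prop := l ≠ [] ∧ l.IsChain (· ≠ ·)

/-- The generators of the reachability chains in degree `k`: tuples `(x₀,…,xₖ)` in which
consecutive entries are distinct, and each entry is joined to the next by a directed path.
There are none for `k < 0`. -/
def gens {V : Type*} (X : Digraph V) (k : ℤ) : Set (List V) :=
  {l | Nondeg l ∧ l.IsChain (Reachable X) ∧ (l.length : ℤ) = k + 1}

/-- The generators in degree `k` of length at most `p`. -/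
def gensLE {V : Type*} (X : Digraph V) (p k : ℤ) : Set (List V) :=
  {l | l ∈ gens X k ∧ ∃ n : ℕ, len X l = n ∧ (n : ℤ) ≤ p}

section Chains

variable (R : Type*) [CommRing R]

/-- A shortcut, so that quotients of chain modules are found by instance search. -/
noncomputable instance instAddCommGroupChains (V : Type*) : AddCommGroup (List V →₀ R) :=
  Finsupp.instAddCommGroup

/-- The basis element of a tuple; zero if the tuple has repeated consecutive entries
(or is empty). -/
noncomputable def term {V : Type*} (l : List V) : List V →₀ R :=
  open Classical in if Nondeg l then Finsupp.single l 1 else 0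

/-- The differential `∂(x₀,…,xₖ) = ∑ᵢ (-1)ⁱ (x₀,…,x̂ᵢ,…,xₖ)`, with terms having repeated
consecutive entries omitted, and with `∂(x₀) = 0`. It is defined on the free module on all finite
tuples, of which the reachability chains in each degree are a submodule. -/
noncomputable def boundary (V : Type*) : (List V →₀ R) →ₗ[R] (List V →₀ R) :=
  Finsupp.linearCombination R
    (fun l => ∑ i ∈ Finset.range l.length, ((-1 : R) ^ i) • term R (l.eraseIdx i))

/-- The reachability chains `RC_k(X)`: the free module on the generators in degree `k`. -/
noncomputable def RC {V : Type*} (X : Digraph V) (k : ℤ) : Submodule R (List V →₀ R) :=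
  Finsupp.supported R R (gens X k)

/-- The length filtration `F_p RC_k(X)`: the span of the generators of length at most `p`. -/
noncomputable def filt {V : Type*} (X : Digraph V) (p k : ℤ) : Submodule R (List V →₀ R) :=
  Finsupp.supported R R (gensLE X p k)

/-- The approximate cycles `A^r_p = {c ∈ F_p RC_k | ∂c ∈ F_{p-r} RC_{k-1}}` in total degree
`k`. -/
noncomputable def approxCycles {V : Type*} (X : Digraph V) (r p k : ℤ) :
    Submodule R (List V →₀ R) :=
  filt R X p k ⊓ (filt R X (p - r) (k - 1)).comap (boundary R V)

/-- The submodule `A^{r-1}_{p-1} + ∂ A^{r-1}_{p+r-1}` of `A^r_p`. -/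
noncomputable def approxBoundaries {V : Type*} (X : Digraph V) (r p k : ℤ) :
    Submodule R (List V →₀ R) :=
  approxCycles R X (r - 1) (p - 1) k ⊔
    (approxCycles R X (r - 1) (p + r - 1) (k + 1)).map (boundary R V)

/-- The entry in filtration degree `p` and total degree `k`, that is `E^r_{p,k-p}(X)`, of the
spectral sequence of the filtered complex `RC(X)` (the magnitude-path spectral sequence):
`E^r_p = A^r_p / (A^{r-1}_{p-1} + ∂ A^{r-1}_{p+r-1})`. -/
abbrev page {V : Type*} (X : Digraph V) (r p k : ℤ) :=
  (approxCycles R X r p k) ⧸ (approxBoundaries R X r p k).submoduleOf (approxCycles R X r p k)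

/-- Bigraded path homology `PH_{k,ℓ}(X) = E^2_{ℓ,k-ℓ}(X)`. -/
abbrev PH {V : Type*} (X : Digraph V) (k l : ℤ) := page R X 2 l k

/-- The map induced on chains: `(x₀,…,xₖ) ↦ (f x₀,…,f xₖ)`, or `0` if the latter has repeated
consecutive entries. -/
noncomputable def chainMap {V W : Type*} (f : V → W) : (List V →₀ R) →ₗ[R] (List W →₀ R) :=
  Finsupp.linearCombination R (fun l => term R (l.map f))

/-! Basic facts: the differential squares to zero and respects the filtration, and a map of
directed graphs induces a filtered chain map, functorially. -/

/-- The alternating sum of all faces, with no terms omitted. -/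
noncomputable def fullBoundary (V : Type*) : (List V →₀ R) →ₗ[R] (List V →₀ R) :=
  Finsupp.linearCombination R
    (fun l => ∑ i ∈ Finset.range l.length, ((-1 : R) ^ i) • Finsupp.single (l.eraseIdx i) 1)

/-- Discard the degenerate tuples. -/
noncomputable def normalize (V : Type*) : (List V →₀ R) →ₗ[R] (List V →₀ R) :=
  Finsupp.linearCombination R (fun l => term R l)

/-- Prepend a vertex. -/
noncomputable def consMap {V : Type*} (x : V) : (List V →₀ R) →ₗ[R] (List V →₀ R) :=
  Finsupp.lmapDomain R R (fun l => x :: l)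

theorem boundary_eq (V : Type*) : boundary R V = normalize R V ∘ₗ fullBoundary R V := by
  ext l : 2
  simp [boundary, normalize, fullBoundary]

theorem fullBoundary_nil (V : Type*) :
    fullBoundary R V (Finsupp.single [] 1) = 0 := by
  simp [fullBoundary]

theorem fullBoundary_cons {V : Type*} (x : V) (l : List V) :
    fullBoundary R V (Finsupp.single (x :: l) 1) =
      Finsupp.single l 1 - consMap R x (fullBoundary R V (Finsupp.single l 1)) := by
  simp only [fullBoundary, Finsupp.linearCombination_single, one_smul, List.length_cons,
    Finset.sum_range_succ', List.eraseIdx_cons_succ, List.eraseIdx_cons_zero, pow_zero, map_sum,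
    map_smul, consMap, Finsupp.lmapDomain_apply, Finsupp.mapDomain_single]
  rw [add_comm, sub_eq_add_neg, ← Finset.sum_neg_distrib]
  congr 1
  refine Finset.sum_congr rfl fun i _ => ?_
  rw [pow_succ, mul_neg_one, neg_smul]

theorem fullBoundary_consMap {V : Type*} (x : V) (c : List V →₀ R) :
    fullBoundary R V (consMap R x c) = c - consMap R x (fullBoundary R V c) := by
  have : fullBoundary R V ∘ₗ consMap R x =
      LinearMap.id - consMap R x ∘ₗ fullBoundary R V := by
    ext l : 2
    simpa [consMap] using fullBoundary_cons R x l
  exact LinearMap.congr_fun this c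

theorem fullBoundary_fullBoundary (V : Type*) : fullBoundary R V ∘ₗ fullBoundary R V = 0 := by
  ext l : 2
  simp only [LinearMap.comp_apply, Finsupp.lsingle_apply, LinearMap.zero_apply]
  induction l with
  | nil => simp [fullBoundary_nil]
  | cons x l ih =>
    rw [fullBoundary_cons, map_sub, fullBoundary_consMap, ih]
    simp

theorem normalize_single {V : Type*} (l : List V) :
    normalize R V (Finsupp.single l 1) = term R l := by
  simp [normalize]

theorem term_of_not {V : Type*} {l : List V} (h : ¬ Nondeg l) : term R l = 0 := by
  simp [term, h]

theorem term_of {V : Type*} {l : List V} (h : Nondeg l) :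
    term R l = Finsupp.single l 1 := by
  simp [term, h]

theorem normalize_cons_cons {V : Type*} (x : V) (c : List V →₀ R) :
    normalize R V (consMap R x (consMap R x c)) = 0 := by
  have : normalize R V ∘ₗ consMap R x ∘ₗ consMap R x = 0 := by
    ext l : 2
    simp only [consMap, LinearMap.comp_apply, Finsupp.lsingle_apply, Finsupp.lmapDomain_apply,
      Finsupp.mapDomain_single, normalize_single, LinearMap.zero_apply]
    exact term_of_not R (by simp [Nondeg])
  exact LinearMap.congr_fun this c

theorem normalize_fullBoundary_of_not_chain {V : Type*} (l : List V)
    (h : ¬ l.IsChain (· ≠ ·)) : normalize R V (fullBoundary R V (Finsupp.single l 1)) = 0 := by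
  suffices H : ∀ l : List V, ¬ l.IsChain (· ≠ ·) →
      normalize R V (fullBoundary R V (Finsupp.single l 1)) = 0 ∧
      ∀ x, normalize R V (consMap R x (fullBoundary R V (Finsupp.single l 1))) = 0 from (H l h).1
  intro l
  induction l with
  | nil => intro h; exact absurd List.IsChain.nil h
  | cons a l ih =>
    intro h
    cases l with
    | nil => exact absurd (List.IsChain.singleton a) h
    | cons b l =>
      by_cases hab : a = b
      · subst hab
        have e : fullBoundary R V (Finsupp.single (a :: a :: l) 1) =
            consMap R a (consMap R a (fullBoundary R V (Finsupp.single l 1))) := by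
          rw [fullBoundary_cons, fullBoundary_cons, map_sub]
          simp [consMap]
        refine ⟨by rw [e, normalize_cons_cons], fun x => ?_⟩
        rw [e]
        have : normalize R V ∘ₗ consMap R x ∘ₗ consMap R a ∘ₗ consMap R a = 0 := by
          ext m : 2
          simp only [consMap, LinearMap.comp_apply, Finsupp.lsingle_apply,
            Finsupp.lmapDomain_apply, Finsupp.mapDomain_single, normalize_single,
            LinearMap.zero_apply]
          exact term_of_not R (by simp [Nondeg])
        exact LinearMap.congr_fun this _
      · have hl : ¬ (b :: l).IsChain (· ≠ ·) := fun h1 => h (List.isChain_cons_cons.2 ⟨hab, h1⟩)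
        have h2 := ih hl
        have key : ∀ x, normalize R V (consMap R x (consMap R a
            (fullBoundary R V (Finsupp.single (b :: l) 1)))) = 0 := by
          intro x
          have : ∀ c, normalize R V (consMap R a c) = 0 →
              normalize R V (consMap R x (consMap R a c)) = 0 := by
            intro c hc
            have : normalize R V ∘ₗ consMap R x ∘ₗ consMap R a =
                normalize R V ∘ₗ consMap R x ∘ₗ normalize R V ∘ₗ consMap R a := by
              ext m : 2
              simp only [consMap, LinearMap.comp_apply, Finsupp.lsingle_apply,
                Finsupp.lmapDomain_apply, Finsupp.mapDomain_single, normalize_single]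
              by_cases hm : Nondeg (a :: m)
              · rw [term_of R hm]
                simp [normalize_single]
              · rw [term_of_not R hm, term_of_not R]
                · simp
                · intro h3
                  exact hm ⟨by simp, (List.isChain_cons_cons.1 h3.2).2⟩
            have h4 := LinearMap.congr_fun this c
            simp only [LinearMap.comp_apply] at h4
            rw [h4, hc]
            simp
          exact this _ (h2.2 a)
        refine ⟨?_, fun x => ?_⟩
        · rw [fullBoundary_cons, map_sub, h2.2 a, normalize_single,
            term_of_not R (fun h3 => hl h3.2), sub_zero]
        · rw [fullBoundary_cons, map_sub, map_sub, key x, sub_zero]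
          simp only [consMap, Finsupp.lmapDomain_apply, Finsupp.mapDomain_single,
            normalize_single]
          refine term_of_not R fun h3 => hl (List.isChain_cons_cons.1 h3.2).2

theorem boundary_normalize (V : Type*) : boundary R V ∘ₗ normalize R V = boundary R V := by
  ext l : 2
  simp only [LinearMap.comp_apply, Finsupp.lsingle_apply, normalize_single]
  by_cases h : Nondeg l
  · rw [term_of R h]
  · rw [term_of_not R h, map_zero, boundary_eq, LinearMap.comp_apply]
    by_cases h0 : l = []
    · subst h0
      rw [fullBoundary_nil, map_zero]
    · rw [normalize_fullBoundary_of_not_chain R l (fun h1 => h ⟨h0, h1⟩)]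

/-- `∂ ∘ ∂ = 0`. -/
theorem boundary_boundary (V : Type*) : boundary R V ∘ₗ boundary R V = 0 := by
  calc boundary R V ∘ₗ boundary R V
      = (boundary R V ∘ₗ normalize R V) ∘ₗ fullBoundary R V := by
        rw [LinearMap.comp_assoc, ← boundary_eq]
    _ = normalize R V ∘ₗ (fullBoundary R V ∘ₗ fullBoundary R V) := by
        rw [boundary_normalize, boundary_eq, LinearMap.comp_assoc]
    _ = 0 := by rw [fullBoundary_fullBoundary, LinearMap.comp_zero]

theorem chainMap_eq {V W : Type*} (f : V → W) :
    chainMap R f = normalize R W ∘ₗ Finsupp.lmapDomain R R (List.map f) := by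
  ext l : 2
  simp [chainMap, normalize_single]

theorem chainMap_normalize {V W : Type*} (f : V → W) :
    chainMap R f ∘ₗ normalize R V = chainMap R f := by
  ext l : 2
  simp only [LinearMap.comp_apply, Finsupp.lsingle_apply, normalize_single]
  by_cases h : Nondeg l
  · rw [term_of R h]
  · rw [term_of_not R h, map_zero]
    simp only [chainMap, Finsupp.linearCombination_single, one_smul]
    rw [term_of_not R]
    intro h1
    refine h ⟨fun h0 => h1.1 (by simp [h0]), ?_⟩
    exact List.isChain_of_isChain_map f (fun a b hab e => hab (congrArg f e)) h1.2

theorem lmapDomain_fullBoundary {V W : Type*} (f : V → W) :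
    Finsupp.lmapDomain R R (List.map f) ∘ₗ fullBoundary R V =
      fullBoundary R W ∘ₗ Finsupp.lmapDomain R R (List.map f) := by
  ext l : 2
  simp [fullBoundary, Finsupp.mapDomain_single, List.eraseIdx_map]

/-- The induced map on chains commutes with the differential. -/
theorem chainMap_boundary {V W : Type*} (f : V → W) :
    chainMap R f ∘ₗ boundary R V = boundary R W ∘ₗ chainMap R f := by
  calc chainMap R f ∘ₗ boundary R V
      = (chainMap R f ∘ₗ normalize R V) ∘ₗ fullBoundary R V := by
        rw [boundary_eq, LinearMap.comp_assoc]
    _ = normalize R W ∘ₗ (Finsupp.lmapDomain R R (List.map f) ∘ₗ fullBoundary R V) := by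
        rw [chainMap_normalize, chainMap_eq, LinearMap.comp_assoc]
    _ = boundary R W ∘ₗ Finsupp.lmapDomain R R (List.map f) := by
        rw [lmapDomain_fullBoundary, ← LinearMap.comp_assoc, ← boundary_eq]
    _ = boundary R W ∘ₗ chainMap R f := by
        rw [chainMap_eq, ← LinearMap.comp_assoc, boundary_normalize]

theorem chainMap_comp {V W U : Type*} (g : W → U) (f : V → W) :
    chainMap R (fun x => g (f x)) = chainMap R g ∘ₗ chainMap R f := by
  rw [chainMap_eq R f, ← LinearMap.comp_assoc, chainMap_normalize]
  ext l : 2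
  simp only [chainMap, LinearMap.comp_apply, Finsupp.lsingle_apply, Finsupp.lmapDomain_apply,
    Finsupp.mapDomain_single, Finsupp.linearCombination_single, one_smul, List.map_map]
  rfl

end Chains

theorem HasPath.trans {V : Type*} {X : Digraph V} {m n : ℕ} {x y z : V}
    (h : HasPath X m x y) (h2 : HasPath X n y z) : HasPath X (m + n) x z := by
  induction h with
  | nil => simpa using h2
  | cons e _ ih =>
    have := HasPath.cons e (ih h2)
    rwa [Nat.add_right_comm] at this

theorem Reachable.trans {V : Type*} {X : Digraph V} {x y z : V}
    (h : Reachable X x y) (h2 : Reachable X y z) : Reachable X x z := by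
  obtain ⟨m, hm⟩ := h
  obtain ⟨n, hn⟩ := h2
  exact ⟨m + n, hm.trans hn⟩

theorem dist_le {V : Type*} {X : Digraph V} {n : ℕ} {x y : V} (h : HasPath X n x y) :
    dist X x y ≤ n := iInf₂_le n h

theorem dist_triangle {V : Type*} (X : Digraph V) (x y z : V) :
    dist X x z ≤ dist X x y + dist X y z := by
  by_cases h1 : Reachable X x y
  · by_cases h2 : Reachable X y z
    · simp only [dist]
      rw [ENat.iInf_add]
      refine le_iInf fun m => ?_
      by_cases hm : HasPath X m x y
      · rw [iInf_pos hm, ENat.add_iInf]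
        refine le_iInf fun n => ?_
        by_cases hn : HasPath X n y z
        · rw [iInf_pos hn]
          refine (iInf₂_le (m + n) (hm.trans hn)).trans ?_
          push_cast
          exact le_rfl
        · rw [iInf_neg hn]; simp
      · rw [iInf_neg hm]; simp
    · have : dist X y z = ⊤ := by
        simp only [dist, iInf_eq_top]
        exact fun n hn => absurd ⟨n, hn⟩ h2
      simp [this]
  · have : dist X x y = ⊤ := by
      simp only [dist, iInf_eq_top]
      exact fun n hn => absurd ⟨n, hn⟩ h1
    simp [this]

theorem HasPath.map {V W : Type*} {X : Digraph V} {Y : Digraph W} (f : DigraphMap X Y)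
    {n : ℕ} {x y : V} (h : HasPath X n x y) :
    ∃ m ≤ n, HasPath Y m (f.toFun x) (f.toFun y) := by
  induction h with
  | nil x => exact ⟨0, le_rfl, .nil _⟩
  | cons e _ ih =>
    obtain ⟨m, hm, hp⟩ := ih
    rcases f.map_adj e with h1 | h1
    · exact ⟨m, by omega, h1 ▸ hp⟩
    · exact ⟨m + 1, by omega, .cons h1 hp⟩

theorem dist_map_le {V W : Type*} {X : Digraph V} {Y : Digraph W} (f : DigraphMap X Y)
    (x y : V) : dist Y (f.toFun x) (f.toFun y) ≤ dist X x y := by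
  refine le_iInf₂ fun n hn => ?_
  obtain ⟨m, hm, hp⟩ := hn.map f
  exact (dist_le hp).trans (by exact_mod_cast hm)

theorem len_map_le {V W : Type*} {X : Digraph V} {Y : Digraph W} (f : DigraphMap X Y)
    (l : List V) : len Y (l.map f.toFun) ≤ len X l := by
  induction l with
  | nil => simp [len]
  | cons x l ih =>
    cases l with
    | nil => simp [len]
    | cons y l =>
      simp only [List.map_cons, len] at ih ⊢
      exact add_le_add (dist_map_le f x y) ih

theorem len_eraseIdx_le {V : Type*} (X : Digraph V) (l : List V) (i : ℕ) :
    len X (l.eraseIdx i) ≤ len X l := by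
  induction l generalizing i with
  | nil => simp
  | cons x l ih =>
    cases l with
    | nil => cases i <;> simp [len]
    | cons y l =>
      cases i with
      | zero => simp [len]
      | succ i =>
        cases i with
        | zero =>
          cases l with
          | nil => simp [len]
          | cons z l =>
            simp only [List.eraseIdx_cons_succ, List.eraseIdx_cons_zero, len]
            rw [← add_assoc]
            exact add_le_add (dist_triangle X x y z) le_rfl
        | succ i =>
          have := ih (i + 1)
          simp only [List.eraseIdx_cons_succ, len] at this ⊢
          exact add_le_add le_rfl this

theorem isChain_map_reachable {V W : Type*} {X : Digraph V} {Y : Digraph W} (f : DigraphMap X Y)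
    {l : List V} (h : l.IsChain (Reachable X)) :
    (l.map f.toFun).IsChain (Reachable Y) := by
  refine List.isChain_map_of_isChain f.toFun (fun a b hab => ?_) h
  obtain ⟨n, hn⟩ := hab
  obtain ⟨m, _, hp⟩ := hn.map f
  exact ⟨m, hp⟩

theorem exists_nat_le {a b : ℕ∞} (hab : a ≤ b) {p : ℤ} (h : ∃ n : ℕ, b = n ∧ (n : ℤ) ≤ p) :
    ∃ n : ℕ, a = n ∧ (n : ℤ) ≤ p := by
  obtain ⟨n, rfl, hn⟩ := h
  obtain ⟨m, rfl⟩ := ENat.ne_top_iff_exists.1 (ne_top_of_le_ne_top (ENat.natCast_ne_top n) hab)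
  refine ⟨m, rfl, ?_⟩
  have : m ≤ n := by exact_mod_cast hab
  omega

section Induced

variable (R : Type*) [CommRing R]

theorem filt_mono {V : Type*} (X : Digraph V) {p q : ℤ} (h : p ≤ q) (k : ℤ) :
    filt R X p k ≤ filt R X q k := by
  refine Finsupp.supported_mono ?_
  rintro l ⟨hl, n, hn, hp⟩
  exact ⟨hl, n, hn, hp.trans h⟩

theorem filt_le_RC {V : Type*} (X : Digraph V) (p k : ℤ) : filt R X p k ≤ RC R X k :=
  Finsupp.supported_mono fun _ h => h.1

theorem map_mem_filt {V W : Type*} {X : Digraph V} {Y : Digraph W} {p k q j : ℤ}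
    (φ : (List V →₀ R) →ₗ[R] (List W →₀ R))
    (h : ∀ l ∈ gensLE X p k, φ (Finsupp.single l 1) ∈ filt R Y q j) {c : List V →₀ R}
    (hc : c ∈ filt R X p k) : φ c ∈ filt R Y q j := by
  rw [filt, Finsupp.supported_eq_span_single] at hc
  refine (Submodule.span_le (p := (filt R Y q j).comap φ)).2 ?_ hc
  rintro _ ⟨l, hl, rfl⟩
  exact h l hl

/-- The differential maps `F_p RC_k` to `F_p RC_{k-1}`. -/
theorem boundary_mem_filt {V : Type*} {X : Digraph V} {p k : ℤ} {c : List V →₀ R}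
    (hc : c ∈ filt R X p k) : boundary R V c ∈ filt R X p (k - 1) := by
  refine map_mem_filt R (boundary R V) (fun l hl => ?_) hc
  simp only [boundary, Finsupp.linearCombination_single, one_smul]
  refine Submodule.sum_mem _ fun i hi => Submodule.smul_mem _ _ ?_
  by_cases h : Nondeg (l.eraseIdx i)
  · rw [term_of R h]
    refine Finsupp.single_mem_supported R 1 ⟨⟨h, ?_, ?_⟩, ?_⟩
    · have : Trans (Reachable X) (Reachable X) (Reachable X) := ⟨Reachable.trans⟩
      exact hl.1.2.1.sublist (List.eraseIdx_sublist l i)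
    · have h1 := List.length_eraseIdx_add_one (Finset.mem_range.1 hi)
      have h2 := hl.1.2.2
      omega
    · exact exists_nat_le (len_eraseIdx_le X l i) hl.2
  · rw [term_of_not R h]
    exact Submodule.zero_mem _

theorem chainMap_mem_filt {V W : Type*} {X : Digraph V} {Y : Digraph W} (f : DigraphMap X Y)
    {p k : ℤ} {c : List V →₀ R} (hc : c ∈ filt R X p k) :
    chainMap R f.toFun c ∈ filt R Y p k := by
  refine map_mem_filt R (chainMap R f.toFun) (fun l hl => ?_) hc
  simp only [chainMap, Finsupp.linearCombination_single, one_smul]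
  by_cases h : Nondeg (l.map f.toFun)
  · rw [term_of R h]
    refine Finsupp.single_mem_supported R 1 ⟨⟨h, isChain_map_reachable f hl.1.2.1, ?_⟩, ?_⟩
    · rw [List.length_map]; exact hl.1.2.2
    · exact exists_nat_le (len_map_le f l) hl.2
  · rw [term_of_not R h]
    exact Submodule.zero_mem _

theorem chainMap_mem_approxCycles {V W : Type*} {X : Digraph V} {Y : Digraph W}
    (f : DigraphMap X Y) {r p k : ℤ} {c : List V →₀ R} (hc : c ∈ approxCycles R X r p k) :
    chainMap R f.toFun c ∈ approxCycles R Y r p k := by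
  refine ⟨chainMap_mem_filt R f hc.1, ?_⟩
  change boundary R W (chainMap R f.toFun c) ∈ filt R Y (p - r) (k - 1)
  have := LinearMap.congr_fun (chainMap_boundary R f.toFun) c
  simp only [LinearMap.comp_apply] at this
  rw [← this]
  exact chainMap_mem_filt R f hc.2

theorem chainMap_mem_approxBoundaries {V W : Type*} {X : Digraph V} {Y : Digraph W}
    (f : DigraphMap X Y) {r p k : ℤ} {c : List V →₀ R} (hc : c ∈ approxBoundaries R X r p k) :
    chainMap R f.toFun c ∈ approxBoundaries R Y r p k := by
  obtain ⟨a, ha, b, ⟨e, he, rfl⟩, rfl⟩ := Submodule.mem_sup.1 hc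
  rw [map_add]
  refine Submodule.add_mem_sup (chainMap_mem_approxCycles R f ha)
    ⟨chainMap R f.toFun e, chainMap_mem_approxCycles R f he, ?_⟩
  have := LinearMap.congr_fun (chainMap_boundary R f.toFun) e
  simp only [LinearMap.comp_apply] at this
  exact this.symm

/-- `A^{r-1}_{p-1} + ∂ A^{r-1}_{p+r-1}` is contained in `A^r_p`. -/
theorem approxBoundaries_le {V : Type*} (X : Digraph V) (r p k : ℤ) :
    approxBoundaries R X r p k ≤ approxCycles R X r p k := by
  refine sup_le ?_ ?_
  · rintro c ⟨h1, h2⟩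
    refine ⟨filt_mono R X (by omega) k h1, ?_⟩
    have : p - 1 - (r - 1) = p - r := by ring
    rwa [this] at h2
  · rintro _ ⟨c, ⟨h1, h2⟩, rfl⟩
    have e : p + r - 1 - (r - 1) = p := by ring
    rw [e, add_sub_cancel_right] at h2
    refine ⟨h2, ?_⟩
    change boundary R V (boundary R V c) ∈ filt R X (p - r) (k - 1)
    have := LinearMap.congr_fun (boundary_boundary R V) c
    simp only [LinearMap.comp_apply, LinearMap.zero_apply] at this
    rw [this]
    exact Submodule.zero_mem _

/-- The map induced by a map of directed graphs on `A^r_p`. -/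
noncomputable def cyclesMap {V W : Type*} {X : Digraph V} {Y : Digraph W}
    (f : DigraphMap X Y) (r p k : ℤ) : approxCycles R X r p k →ₗ[R] approxCycles R Y r p k :=
  (chainMap R f.toFun).restrict fun _ hc => chainMap_mem_approxCycles R f hc

/-- The map induced by a map of directed graphs on the pages of the spectral sequence. -/
noncomputable def pageMap {V W : Type*} {X : Digraph V} {Y : Digraph W}
    (f : DigraphMap X Y) (r p k : ℤ) : page R X r p k →ₗ[R] page R Y r p k :=
  Submodule.mapQ _ _ (cyclesMap R f r p k) fun _ hc => chainMap_mem_approxBoundaries R f hc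

/-- The map `PH_{k,ℓ}(f) : PH_{k,ℓ}(X) → PH_{k,ℓ}(Y)`. -/
noncomputable def PHmap {V W : Type*} {X : Digraph V} {Y : Digraph W}
    (f : DigraphMap X Y) (k l : ℤ) : PH R X k l →ₗ[R] PH R Y k l := pageMap R f 2 l k

theorem PHmap_id {V : Type*} (X : Digraph V) (k l : ℤ) (z : PH R X k l) :
    PHmap R (DigraphMap.id X) k l z = z := by
  obtain ⟨c, rfl⟩ := Submodule.Quotient.mk_surjective _ z
  refine congrArg (Submodule.Quotient.mk (p := (approxBoundaries R X 2 l k).submoduleOf _))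
    (Subtype.ext ?_)
  have hc := c.2.1
  rw [filt, Finsupp.supported_eq_span_single] at hc
  refine (Submodule.span_le
    (p := LinearMap.eqLocus (chainMap R (DigraphMap.id X).toFun) LinearMap.id)).2 ?_ hc
  rintro _ ⟨m, hm, rfl⟩
  have e : m.map (fun x => x) = m := List.map_id' m
  change chainMap R (fun x => x) (Finsupp.single m 1) = Finsupp.single m 1
  simp only [chainMap, Finsupp.linearCombination_single, one_smul, e]
  exact term_of R hm.1.1

theorem PHmap_comp {V W U : Type*} {X : Digraph V} {Y : Digraph W} {Z : Digraph U}
    (g : DigraphMap Y Z) (f : DigraphMap X Y) (k l : ℤ) (z : PH R X k l) :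
    PHmap R (g.comp f) k l z = PHmap R g k l (PHmap R f k l z) := by
  obtain ⟨c, rfl⟩ := Submodule.Quotient.mk_surjective _ z
  refine congrArg (Submodule.Quotient.mk (p := (approxBoundaries R Z 2 l k).submoduleOf _))
    (Subtype.ext ?_)
  exact LinearMap.congr_fun (chainMap_comp R g.toFun f.toFun) c.1

/-- The reduced group `ker (PH_{k,ℓ}(X) → PH_{k,ℓ}(•))`. -/
noncomputable def redPH {V : Type*} (X : Digraph V) (k l : ℤ) : Submodule R (PH R X k l) :=
  LinearMap.ker (PHmap R (toPoint X) k l)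

/-- The map induced on reduced groups. -/
noncomputable def redPHmap {V W : Type*} {X : Digraph V} {Y : Digraph W}
    (f : DigraphMap X Y) (k l : ℤ) : redPH R X k l →ₗ[R] redPH R Y k l :=
  (PHmap R f k l).restrict fun z hz => by
    change PHmap R (toPoint Y) k l (PHmap R f k l z) = 0
    rw [← PHmap_comp]
    exact hz

end Induced

/-- The suspension `SX`: two new vertices, with an edge from each of them to each vertex of
`X`. -/
def susp {V : Type u} (X : Digraph V) : Digraph (V ⊕ Bool) where
  Adj
    | .inl x, .inl y => X.Adj x y
    | .inr _, .inl _ => True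
    | _, .inr _ => False

/-- The map `Sf : SX → SY` that fixes the two new vertices. -/
def suspMap {V W : Type*} {X : Digraph V} {Y : Digraph W} (f : DigraphMap X Y) :
    DigraphMap (susp X) (susp Y) where
  toFun := Sum.map f.toFun id
  map_adj := by
    rintro (x | x) (y | y) h
    · rcases f.map_adj h with h1 | h1
      · exact Or.inl (congrArg Sum.inl h1)
      · exact Or.inr h1
    · exact h.elim
    · exact Or.inr trivial
    · exact h.elim

/-- The vertices of the `n`-fold suspension of the empty graph. -/
def IterVert : ℕ → Type
  | 0 => Empty
  | n + 1 => IterVert n ⊕ Bool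

/-- The `n`-fold suspension of the empty graph. -/
def iterSusp : (n : ℕ) → Digraph (IterVert n)
  | 0 => (⊥ : Digraph Empty)
  | n + 1 => susp (iterSusp n)

/-- The sphere `𝕊ⁿ = Sⁿ⁺¹ ∅`. -/
def sphere (n : ℕ) : Digraph (IterVert (n + 1)) := iterSusp (n + 1)

end MagPath

/-! Work with the augmented complex, in which the empty tuple is one more generator, of degree -1
and length -1. In a suspension no edge enters a new vertex, so a new vertex can occur only as the
first entry of a tuple. Every generator for `susp X` is thus either a generator `l` for `X` or a
cone `(±1, l)`, and coning raises degree and length by exactly one. This holds even for empty `l`,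
because `(±1)` has degree 0 and length 0; that is why the empty tuple gets length -1.

Removing the apex `true` and discarding all other generators (`suspStrip`) anticommutes with the
differential, and so does its section, the difference of the two cones (`suspDiff`). Coning with
apex `false` on the tuples of `X` (`suspHomotopy`) is a homotopy from `suspDiff ∘ suspStrip` to the
identity (`suspHomotopy_spec`). It raises filtration by one, which is harmless on page 2
(`sub_suspDiff_suspStrip_mem`). Hence `augSuspEquiv`: the second augmented page of `susp X` is that
of `X` shifted by (1,1), for every `X`, empty or not.

For nonempty `X` the second augmented page is the kernel of the map to the path homology of the
point (`augPageEquiv`); this uses that all 0-chains have length 0, so that the augmentation matters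
only in bidegree (0,0). Combining the two gives part (a). Part (b) follows because the path homology
of the point is `R` in bidegree (0,0) and zero elsewhere, and a vertex splits the map to the point.
For the spheres, iterate `augSuspEquiv` down to the empty graph, whose augmented complex is `R` in
bidegree (-1,-1). -/

namespace MagPath

/-! ### Isomorphisms of subquotients of modules. -/

section Subquotient

variable {R M N : Type*} [CommRing R] [AddCommGroup M] [AddCommGroup N] [Module R M] [Module R N]

/-- A linear map that induces a bijection of subquotients. -/
noncomputable def subquotientEquiv {A B : Submodule R M} {A' B' : Submodule R N} (φ : M →ₗ[R] N)
    (hA : ∀ c ∈ A, φ c ∈ A') (hB : ∀ c ∈ B, φ c ∈ B') (hinj : ∀ c ∈ A, φ c ∈ B' → c ∈ B)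
    (hsurj : ∀ d ∈ A', ∃ c ∈ A, d - φ c ∈ B') :
    (A ⧸ B.submoduleOf A) ≃ₗ[R] (A' ⧸ B'.submoduleOf A') :=
  LinearEquiv.ofBijective
    (Submodule.mapQ (B.submoduleOf A) (B'.submoduleOf A') (φ.restrict hA) fun c hc => hB c hc) <| by
    constructor
    · rw [injective_iff_map_eq_zero]
      intro z hz
      obtain ⟨c, rfl⟩ := Submodule.Quotient.mk_surjective _ z
      exact (Submodule.Quotient.mk_eq_zero _).2
        (hinj c c.2 ((Submodule.Quotient.mk_eq_zero (B'.submoduleOf A')).1 hz))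
    · intro z
      obtain ⟨d, rfl⟩ := Submodule.Quotient.mk_surjective _ z
      obtain ⟨c, hc, hd⟩ := hsurj d d.2
      exact ⟨Submodule.Quotient.mk ⟨c, hc⟩, Eq.symm ((Submodule.Quotient.eq _).2 hd)⟩

theorem subsingleton_subquotient {A B : Submodule R M} (h : A ≤ B) :
    Subsingleton (A ⧸ B.submoduleOf A) :=
  Submodule.Quotient.subsingleton_iff.2 (Submodule.comap_subtype_eq_top.2 h)

/-- The quotient of a free module of rank one by zero. -/
noncomputable def subquotientSingletonEquiv {V : Type*} (a : List V)
    {A B : Submodule R (List V →₀ R)}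
    (hA : A = Finsupp.supported R R {a}) (hB : B = ⊥) : (A ⧸ B.submoduleOf A) ≃ₗ[R] R :=
  (Submodule.quotEquivOfEqBot _ (by
      subst hB
      exact LinearMap.ker_eq_bot.2 A.subtype_injective)).trans <|
    (LinearEquiv.ofEq _ _ hA).trans <|
      (Finsupp.supportedEquivFinsupp {a}).trans (Finsupp.uniqueLinearEquiv R R ⟨a, rfl⟩)

end Subquotient

/-! ### The augmented reachability complex and its length filtration. -/

section Augmented

variable (R : Type*) [CommRing R]

/-- The sum of the coefficients of the tuples of length one. -/
noncomputable def augmentation (V : Type*) : (List V →₀ R) →ₗ[R] R :=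
  Finsupp.lapply [] ∘ₗ fullBoundary R V

theorem augmentation_single {V : Type*} (l : List V) :
    augmentation R V (Finsupp.single l 1) = if l.length = 1 then 1 else 0 := by
  cases l with
  | nil => simp [augmentation, fullBoundary_nil]
  | cons x l =>
    have h : ∀ c : List V →₀ R, consMap R x c [] = 0 := fun c =>
      Finsupp.mapDomain_of_notMem_range _ _ (by simp)
    simp [augmentation, fullBoundary_cons, h, Finsupp.single_apply]

/-- Discard the degenerate tuples, but keep the empty one. -/
noncomputable def augNormalize (V : Type*) : (List V →₀ R) →ₗ[R] (List V →₀ R) :=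
  normalize R V + Finsupp.lsingle [] ∘ₗ Finsupp.lapply []

open Classical in
theorem augNormalize_single {V : Type*} (l : List V) :
    augNormalize R V (Finsupp.single l 1) =
      if l.IsChain (· ≠ ·) then Finsupp.single l 1 else 0 := by
  by_cases h : l = []
  · subst h
    simp [augNormalize, normalize_single, term, Nondeg]
  · simp [augNormalize, normalize_single, term, Nondeg, h]

/-- The differential of the augmented complex, in which the empty tuple is a generator. -/
noncomputable def augBoundary (V : Type*) : (List V →₀ R) →ₗ[R] (List V →₀ R) :=
  augNormalize R V ∘ₗ fullBoundary R V

theorem augBoundary_eq (V : Type*) :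
    augBoundary R V = boundary R V + Finsupp.lsingle [] ∘ₗ augmentation R V := by
  rw [augBoundary, augNormalize, LinearMap.add_comp, boundary_eq, LinearMap.comp_assoc]
  rfl

theorem augBoundary_apply {V : Type*} (c : List V →₀ R) :
    augBoundary R V c = boundary R V c + Finsupp.single [] (augmentation R V c) := by
  rw [augBoundary_eq]
  rfl

theorem augBoundary_nil (V : Type*) : augBoundary R V (Finsupp.single [] 1) = 0 := by
  rw [augBoundary, LinearMap.comp_apply, fullBoundary_nil, map_zero]

theorem augmentation_normalize (V : Type*) :
    augmentation R V ∘ₗ normalize R V = augmentation R V := by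
  ext l
  simp only [LinearMap.comp_apply, Finsupp.lsingle_apply, normalize_single]
  by_cases h : Nondeg l
  · rw [term_of R h]
  · rw [term_of_not R h, map_zero, augmentation_single, if_neg]
    intro h1
    obtain ⟨x, rfl⟩ := List.length_eq_one_iff.1 h1
    exact h ⟨by simp, by simp⟩

/-- The degenerate tuples span a subcomplex, so discarding them first changes nothing. This reduces
identities for `augBoundary` to identities for `fullBoundary`, where no terms are omitted. -/
theorem augBoundary_augNormalize (V : Type*) :
    augBoundary R V ∘ₗ augNormalize R V = augBoundary R V := by
  have h : augBoundary R V ∘ₗ (Finsupp.lsingle [] : R →ₗ[R] List V →₀ R) = 0 := by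
    ext
    simp [augBoundary_nil]
  rw [augNormalize, LinearMap.comp_add, ← LinearMap.comp_assoc, h, LinearMap.zero_comp, add_zero,
    augBoundary_eq, LinearMap.add_comp, boundary_normalize, LinearMap.comp_assoc,
    augmentation_normalize]

theorem augBoundary_augBoundary {V : Type*} (c : List V →₀ R) :
    augBoundary R V (augBoundary R V c) = 0 := by
  have h : augBoundary R V ∘ₗ augBoundary R V = 0 := by
    conv_lhs => enter [2]; rw [augBoundary]
    rw [← LinearMap.comp_assoc, augBoundary_augNormalize, augBoundary, LinearMap.comp_assoc,
      fullBoundary_fullBoundary, LinearMap.comp_zero]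
  exact LinearMap.congr_fun h c

/-- The map induced on augmented chains. -/
noncomputable def augChainMap {V W : Type*} (f : V → W) : (List V →₀ R) →ₗ[R] (List W →₀ R) :=
  augNormalize R W ∘ₗ Finsupp.lmapDomain R R (List.map f)

/-- The image of a tuple with a repetition again has a repetition. -/
theorem augChainMap_augNormalize {V W : Type*} (f : V → W) :
    augChainMap R f ∘ₗ augNormalize R V = augChainMap R f := by
  ext l : 2
  simp only [LinearMap.comp_apply, Finsupp.lsingle_apply, augNormalize_single]
  split_ifs with h
  · rfl
  · rw [map_zero, augChainMap, LinearMap.comp_apply, Finsupp.lmapDomain_apply,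
      Finsupp.mapDomain_single, augNormalize_single, if_neg]
    exact fun h1 => h (List.isChain_of_isChain_map f (fun a b hab e => hab (congrArg f e)) h1)

theorem augChainMap_augBoundary {V W : Type*} (f : V → W) (c : List V →₀ R) :
    augChainMap R f (augBoundary R V c) = augBoundary R W (augChainMap R f c) := by
  have h : augChainMap R f ∘ₗ augBoundary R V = augBoundary R W ∘ₗ augChainMap R f := by
    rw [augBoundary, ← LinearMap.comp_assoc, augChainMap_augNormalize]
    conv_rhs => rw [augChainMap, ← LinearMap.comp_assoc, augBoundary_augNormalize, augBoundary]
    rw [augChainMap, LinearMap.comp_assoc, lmapDomain_fullBoundary, LinearMap.comp_assoc]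
  exact LinearMap.congr_fun h c

theorem augChainMap_eq {V W : Type*} (f : V → W) {l : List V} (h : l ≠ []) :
    augChainMap R f (Finsupp.single l 1) = chainMap R f (Finsupp.single l 1) := by
  simp [augChainMap, chainMap_eq, augNormalize, h]

theorem augChainMap_nil {V W : Type*} (f : V → W) :
    augChainMap R f (Finsupp.single [] 1) = Finsupp.single [] 1 := by
  simp [augChainMap, augNormalize_single]

/-- Forget the empty tuple. -/
noncomputable def forgetEmpty (V : Type*) : (List V →₀ R) →ₗ[R] (List V →₀ R) :=
  LinearMap.id - Finsupp.lsingle [] ∘ₗ Finsupp.lapply []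

theorem forgetEmpty_single {V : Type*} {l : List V} (h : l ≠ []) :
    forgetEmpty R V (Finsupp.single l 1) = Finsupp.single l 1 := by
  simp [forgetEmpty, h]

theorem forgetEmpty_nil (V : Type*) : forgetEmpty R V (Finsupp.single [] 1) = 0 := by
  simp [forgetEmpty]

theorem chainMap_forgetEmpty {V W : Type*} (f : V → W) (c : List V →₀ R) :
    chainMap R f (forgetEmpty R V c) = forgetEmpty R W (augChainMap R f c) := by
  have h : chainMap R f ∘ₗ forgetEmpty R V = forgetEmpty R W ∘ₗ augChainMap R f := by
    ext l : 2
    simp only [LinearMap.comp_apply, Finsupp.lsingle_apply]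
    by_cases hl : l = []
    · subst hl
      rw [forgetEmpty_nil, augChainMap_nil, forgetEmpty_nil, map_zero]
    · rw [forgetEmpty_single R hl, augChainMap_eq R f hl]
      simp only [chainMap, Finsupp.linearCombination_single, one_smul]
      by_cases h : Nondeg (l.map f)
      · rw [term_of R h, forgetEmpty_single R h.1]
      · rw [term_of_not R h, map_zero]
  exact LinearMap.congr_fun h c

theorem boundary_forgetEmpty {V : Type*} (c : List V →₀ R) :
    boundary R V (forgetEmpty R V c) = boundary R V c := by
  have h : boundary R V ∘ₗ forgetEmpty R V = boundary R V := by
    ext l : 2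
    simp only [LinearMap.comp_apply, Finsupp.lsingle_apply]
    by_cases hl : l = []
    · subst hl
      simp [forgetEmpty_nil, boundary]
    · rw [forgetEmpty_single R hl]
  exact LinearMap.congr_fun h c

/-- Together with `boundary_forgetEmpty`, this makes `forgetEmpty` a chain map from the augmented
complex to the original one. -/
theorem forgetEmpty_augBoundary {V : Type*} (c : List V →₀ R) :
    forgetEmpty R V (augBoundary R V c) = boundary R V c := by
  have h : forgetEmpty R V ∘ₗ augNormalize R V = normalize R V := by
    ext l : 2
    simp only [LinearMap.comp_apply, Finsupp.lsingle_apply, augNormalize_single, normalize_single,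
      term, Nondeg]
    by_cases hl : l = []
    · subst hl
      simp [forgetEmpty_nil]
    · by_cases hc : l.IsChain (· ≠ ·) <;> simp [hl, hc, forgetEmpty_single]
  rw [augBoundary, boundary_eq, ← h]
  rfl

/-- The generators of the augmented complex in degree `k` of length at most `p`; the empty tuple
has degree and length `-1`. -/
def augGens {V : Type*} (X : Digraph V) (p k : ℤ) : Set (List V) :=
  gensLE X p k ∪ {l | l = [] ∧ k = -1 ∧ -1 ≤ p}

/-- The length filtration of the augmented complex. -/
noncomputable def augFilt {V : Type*} (X : Digraph V) (p k : ℤ) : Submodule R (List V →₀ R) :=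
  Finsupp.supported R R (augGens X p k)

/-- The approximate cycles of the augmented complex. -/
noncomputable def augCycles {V : Type*} (X : Digraph V) (r p k : ℤ) :
    Submodule R (List V →₀ R) :=
  augFilt R X p k ⊓ (augFilt R X (p - r) (k - 1)).comap (augBoundary R V)

/-- The approximate boundaries of the augmented complex. -/
noncomputable def augBoundaries {V : Type*} (X : Digraph V) (r p k : ℤ) :
    Submodule R (List V →₀ R) :=
  augCycles R X (r - 1) (p - 1) k ⊔
    (augCycles R X (r - 1) (p + r - 1) (k + 1)).map (augBoundary R V)

/-- The pages of the spectral sequence of the augmented complex. -/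
abbrev augPage {V : Type*} (X : Digraph V) (r p k : ℤ) :=
  (augCycles R X r p k) ⧸ (augBoundaries R X r p k).submoduleOf (augCycles R X r p k)

variable {R}

/-- Reduces every later membership claim about filtered chains to generators. -/
theorem augFilt_induction {V : Type*} {X : Digraph V} {p k : ℤ} {N : Type*} [AddCommGroup N]
    [Module R N] (φ : (List V →₀ R) →ₗ[R] N) (S : Submodule R N)
    (h : ∀ l ∈ augGens X p k, φ (Finsupp.single l 1) ∈ S) {c : List V →₀ R}
    (hc : c ∈ augFilt R X p k) : φ c ∈ S := by
  rw [augFilt, Finsupp.supported_eq_span_single] at hc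
  refine (Submodule.span_le (p := S.comap φ)).2 ?_ hc
  rintro _ ⟨l, hl, rfl⟩
  exact h l hl

theorem augFilt_eqOn {V : Type*} {X : Digraph V} {p k : ℤ} {N : Type*} [AddCommGroup N]
    [Module R N] (φ ψ : (List V →₀ R) →ₗ[R] N)
    (h : ∀ l ∈ augGens X p k, φ (Finsupp.single l 1) = ψ (Finsupp.single l 1)) {c : List V →₀ R}
    (hc : c ∈ augFilt R X p k) : φ c = ψ c := by
  have := augFilt_induction (φ - ψ) ⊥ (fun l hl => by simp [h l hl]) hc
  simpa [sub_eq_zero] using this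

theorem filt_le_augFilt {V : Type*} (X : Digraph V) (p k : ℤ) :
    filt R X p k ≤ augFilt R X p k :=
  Finsupp.supported_mono Set.subset_union_left

theorem augFilt_eq_filt {V : Type*} (X : Digraph V) (p : ℤ) {k : ℤ} (hk : k ≠ -1) :
    augFilt R X p k = filt R X p k := by
  refine congrArg (Finsupp.supported R R) ?_
  simp [augGens, hk]

theorem augFilt_mono {V : Type*} (X : Digraph V) {p q : ℤ} (h : p ≤ q) (k : ℤ) :
    augFilt R X p k ≤ augFilt R X q k := by
  refine Finsupp.supported_mono ?_
  rintro l (⟨hl, n, hn, hp⟩ | ⟨h1, h2, h3⟩)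
  · exact Or.inl ⟨hl, n, hn, hp.trans h⟩
  · exact Or.inr ⟨h1, h2, h3.trans h⟩

theorem isChain_of_mem_augGens {V : Type*} {X : Digraph V} {p k : ℤ} {l : List V}
    (hl : l ∈ augGens X p k) : l.IsChain (· ≠ ·) := by
  rcases hl with h | h
  · exact h.1.1.2
  · rw [h.1]; exact .nil

theorem augNormalize_of_mem {V : Type*} {X : Digraph V} {p k : ℤ} {c : List V →₀ R}
    (hc : c ∈ augFilt R X p k) : augNormalize R V c = c := by
  refine augFilt_eqOn (augNormalize R V) LinearMap.id (fun l hl => ?_) hc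
  rw [augNormalize_single, if_pos (isChain_of_mem_augGens hl)]
  rfl

theorem augChainMap_mem_augFilt {V W : Type*} {X : Digraph V} {Y : Digraph W}
    (f : DigraphMap X Y) {p k : ℤ} {c : List V →₀ R} (hc : c ∈ augFilt R X p k) :
    augChainMap R f.toFun c ∈ augFilt R Y p k := by
  refine augFilt_induction (augChainMap R f.toFun) _ (fun l hl => ?_) hc
  rcases hl with h | ⟨rfl, h⟩
  · rw [augChainMap_eq R _ h.1.1.1]
    exact filt_le_augFilt Y p k (chainMap_mem_filt R f (Finsupp.single_mem_supported R 1 h))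
  · rw [augChainMap_nil]
    exact Finsupp.single_mem_supported R 1 (Or.inr ⟨rfl, h⟩)

theorem augChainMap_mem_augCycles {V W : Type*} {X : Digraph V} {Y : Digraph W}
    (f : DigraphMap X Y) {r p k : ℤ} {c : List V →₀ R} (hc : c ∈ augCycles R X r p k) :
    augChainMap R f.toFun c ∈ augCycles R Y r p k := by
  refine ⟨augChainMap_mem_augFilt f hc.1, ?_⟩
  rw [SetLike.mem_coe, Submodule.mem_comap, ← augChainMap_augBoundary]
  exact augChainMap_mem_augFilt f hc.2

theorem forgetEmpty_mem_filt {V : Type*} {X : Digraph V} {p k : ℤ} {c : List V →₀ R}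
    (hc : c ∈ augFilt R X p k) : forgetEmpty R V c ∈ filt R X p k := by
  refine augFilt_induction (forgetEmpty R V) _ (fun l hl => ?_) hc
  rcases hl with h | ⟨rfl, h⟩
  · rw [forgetEmpty_single R h.1.1.1]
    exact Finsupp.single_mem_supported R 1 h
  · rw [forgetEmpty_nil]
    exact Submodule.zero_mem _

theorem forgetEmpty_mem_approxCycles {V : Type*} {X : Digraph V} {r p k : ℤ} {c : List V →₀ R}
    (hc : c ∈ augCycles R X r p k) : forgetEmpty R V c ∈ approxCycles R X r p k := by
  refine ⟨forgetEmpty_mem_filt hc.1, ?_⟩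
  rw [SetLike.mem_coe, Submodule.mem_comap, boundary_forgetEmpty, ← forgetEmpty_augBoundary]
  exact forgetEmpty_mem_filt hc.2

theorem forgetEmpty_mem_approxBoundaries {V : Type*} {X : Digraph V} {r p k : ℤ}
    {c : List V →₀ R} (hc : c ∈ augBoundaries R X r p k) :
    forgetEmpty R V c ∈ approxBoundaries R X r p k := by
  obtain ⟨a, ha, b, ⟨e, he, rfl⟩, rfl⟩ := Submodule.mem_sup.1 hc
  rw [map_add, forgetEmpty_augBoundary, ← boundary_forgetEmpty]
  exact Submodule.add_mem_sup (forgetEmpty_mem_approxCycles ha)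
    ⟨_, forgetEmpty_mem_approxCycles he, rfl⟩

theorem forgetEmpty_of_mem {V : Type*} {X : Digraph V} {p k : ℤ} {c : List V →₀ R}
    (hc : c ∈ filt R X p k) : forgetEmpty R V c = c := by
  have h : c [] = 0 := by
    by_contra h
    exact (((Finsupp.mem_supported R c).1 hc) (Finsupp.mem_support_iff.2 h)).1.1.1 rfl
  simp [forgetEmpty, h]

end Augmented

/-! ### Chains of the suspension: cones, homotopy, and the isomorphism on the second page. -/

section Suspension

variable {V : Type*} {X : Digraph V}

theorem hasPath_susp_inr {n : ℕ} {x : V ⊕ Bool} {b : Bool}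
    (h : HasPath (susp X) n x (.inr b)) : x = .inr b := by
  generalize hy : (Sum.inr b : V ⊕ Bool) = y at h
  induction h with
  | nil => rfl
  | @cons n x y z e _ ih =>
    subst hy
    obtain rfl := ih rfl
    cases x <;> exact e.elim

/-- A path that starts in `X` cannot leave it, since no edge ends at a new vertex; so distances in
`X` are unchanged by suspension. -/
theorem hasPath_susp_inl {n : ℕ} {x y : V} :
    HasPath (susp X) n (.inl x) (.inl y) ↔ HasPath X n x y := by
  refine ⟨fun h => ?_, fun h => ?_⟩
  · generalize hx : (Sum.inl x : V ⊕ Bool) = x' at h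
    generalize hy : (Sum.inl y : V ⊕ Bool) = y' at h
    induction h generalizing x with
    | nil =>
      obtain rfl : x = y := Sum.inl.inj (hx.trans hy.symm)
      exact .nil _
    | @cons n a b c e _ ih =>
      subst hx
      cases b with
      | inl b => exact .cons e (ih rfl hy)
      | inr b => exact e.elim
  · induction h with
    | nil => exact .nil _
    | @cons n a b c e _ ih => exact .cons (y := Sum.inl b) e ih

theorem reachable_susp_inl {x y : V} :
    Reachable (susp X) (.inl x) (.inl y) ↔ Reachable X x y :=
  exists_congr fun _ => hasPath_susp_inl

theorem dist_susp_inl (x y : V) : dist (susp X) (.inl x) (.inl y) = dist X x y := by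
  simp only [dist, hasPath_susp_inl]

theorem hasPath_susp_inr_inl (b : Bool) (x : V) :
    HasPath (susp X) 1 (.inr b) (.inl x) :=
  .cons (y := Sum.inl x) trivial (.nil _)

theorem dist_susp_inr_inl (b : Bool) (x : V) : dist (susp X) (.inr b) (.inl x) = 1 := by
  refine le_antisymm (dist_le (hasPath_susp_inr_inl b x)) (le_iInf₂ fun n hn => ?_)
  cases hn with
  | cons => simp

theorem len_susp_map_inl (l : List V) : len (susp X) (l.map .inl) = len X l := by
  induction l with
  | nil => rfl
  | cons x l ih =>
    cases l with
    | nil => rfl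
    | cons y l =>
      simp only [List.map_cons, len, dist_susp_inl] at ih ⊢
      rw [ih]

theorem len_susp_inr_cons (b : Bool) (x : V) (l : List V) :
    len (susp X) (.inr b :: (x :: l).map .inl) = 1 + len X (x :: l) := by
  rw [← len_susp_map_inl (X := X) (x :: l)]
  simp only [List.map_cons, len, dist_susp_inr_inl]

theorem isChain_ne_map_inl {l : List V} :
    (l.map (Sum.inl : V → V ⊕ Bool)).IsChain (· ≠ ·) ↔ l.IsChain (· ≠ ·) := by
  simp [List.isChain_map]

theorem isChain_ne_inr_cons {b : Bool} {l : List V} :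
    ((Sum.inr b : V ⊕ Bool) :: l.map .inl).IsChain (· ≠ ·) ↔ l.IsChain (· ≠ ·) := by
  cases l with
  | nil => simp
  | cons x l => rw [List.map_cons, List.isChain_cons_cons, ← List.map_cons, isChain_ne_map_inl]; simp

theorem isChain_reachable_map_inl {l : List V} :
    (l.map Sum.inl).IsChain (Reachable (susp X)) ↔ l.IsChain (Reachable X) := by
  simp [List.isChain_map, reachable_susp_inl]

theorem isChain_reachable_inr_cons {b : Bool} {l : List V} :
    (.inr b :: l.map Sum.inl).IsChain (Reachable (susp X)) ↔ l.IsChain (Reachable X) := by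
  cases l with
  | nil => simp
  | cons x l =>
    rw [List.map_cons, List.isChain_cons_cons, ← List.map_cons, isChain_reachable_map_inl]
    exact and_iff_right ⟨1, hasPath_susp_inr_inl b x⟩

/-- A new vertex is reachable only from itself, and consecutive entries differ, so it can stand only
in first position. -/
theorem exists_eq_map_inl {a : V ⊕ Bool} {l : List (V ⊕ Bool)} (h1 : (a :: l).IsChain (· ≠ ·))
    (h2 : (a :: l).IsChain (Reachable (susp X))) : ∃ m : List V, l = m.map .inl := by
  induction l generalizing a with
  | nil => exact ⟨[], rfl⟩
  | cons b l ih =>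
    rw [List.isChain_cons_cons] at h1 h2
    obtain ⟨m, rfl⟩ := ih h1.2 h2.2
    cases b with
    | inl x => exact ⟨x :: m, rfl⟩
    | inr b =>
      obtain ⟨n, hn⟩ := h2.1
      exact (h1.1 (hasPath_susp_inr hn)).elim

theorem map_inl_mem_augGens {p k : ℤ} {l : List V} :
    l.map .inl ∈ augGens (susp X) p k ↔ l ∈ augGens X p k := by
  simp only [augGens, gensLE, gens, Nondeg, Set.mem_union, Set.mem_ofPred_eq, isChain_ne_map_inl,
    isChain_reachable_map_inl, len_susp_map_inl, List.length_map, ne_eq, List.map_eq_nil_iff]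

/-- The distance from a new vertex to any vertex of `X` is 1, so coning adds 1 to the length as well
as to the degree. The empty tuple obeys the same rule thanks to its bidegree (-1,-1). -/
theorem inr_cons_mem_augGens {p k : ℤ} {b : Bool} {l : List V} :
    .inr b :: l.map .inl ∈ augGens (susp X) p k ↔ l ∈ augGens X (p - 1) (k - 1) := by
  simp only [augGens, gensLE, gens, Nondeg, Set.mem_union, Set.mem_ofPred_eq, isChain_ne_inr_cons,
    isChain_reachable_inr_cons, List.length_map, ne_eq, List.length_cons, reduceCtorEq,
    not_false_eq_true, true_and, false_and, or_false]
  cases l with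
  | nil =>
    simp only [List.map_nil, len, List.length_nil]
    constructor
    · rintro ⟨⟨-, -, h⟩, n, hn, hp⟩
      exact Or.inr ⟨trivial, by omega, by omega⟩
    · rintro (h | ⟨-, h1, h2⟩)
      · simp at h
      · exact ⟨⟨.nil, .nil, by push_cast; omega⟩, 0, rfl, by push_cast; omega⟩
  | cons x l =>
    rw [len_susp_inr_cons]
    simp only [reduceCtorEq, false_and, or_false, not_false_eq_true, true_and, List.length_cons]
    push_cast
    constructor
    · rintro ⟨⟨h1, h2, h3⟩, n, hn, hp⟩
      -- The total length is finite, hence so is the length of the base; then 1 can be subtracted in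
      -- the natural numbers.
      have hne : len X (x :: l) ≠ ⊤ := by
        intro h
        rw [h] at hn
        simp at hn
      obtain ⟨m, hm⟩ := ENat.ne_top_iff_exists.1 hne
      rw [← hm] at hn
      have : 1 + m = n := by exact_mod_cast hn
      exact ⟨⟨h1, h2, by omega⟩, m, hm.symm, by omega⟩
    · rintro ⟨⟨h1, h2, h3⟩, n, hn, hp⟩
      exact ⟨⟨h1, h2, by omega⟩, 1 + n, by rw [hn]; push_cast; rfl, by push_cast; omega⟩

theorem mem_augGens_susp {p k : ℤ} {l : List (V ⊕ Bool)} (h : l ∈ augGens (susp X) p k) :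
    (∃ m ∈ augGens X p k, l = m.map .inl) ∨
      ∃ b, ∃ m ∈ augGens X (p - 1) (k - 1), l = .inr b :: m.map .inl := by
  have key : (∃ m : List V, l = m.map .inl) ∨ ∃ b, ∃ m : List V, l = .inr b :: m.map .inl := by
    rcases h with h | ⟨rfl, -⟩
    · cases l with
      | nil => exact Or.inl ⟨[], rfl⟩
      | cons a l =>
        obtain ⟨m, rfl⟩ := exists_eq_map_inl h.1.1.2 h.1.2.1
        cases a with
        | inl x => exact Or.inl ⟨x :: m, rfl⟩
        | inr b => exact Or.inr ⟨b, m, rfl⟩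
    · exact Or.inl ⟨[], rfl⟩
  rcases key with ⟨m, rfl⟩ | ⟨b, m, rfl⟩
  · exact Or.inl ⟨m, map_inl_mem_augGens.1 h, rfl⟩
  · exact Or.inr ⟨b, m, inr_cons_mem_augGens.1 h, rfl⟩

variable (R : Type*) [CommRing R]

/-- The inclusion of the chains of `X` into those of the suspension. -/
noncomputable def suspIncl (V : Type*) : (List V →₀ R) →ₗ[R] (List (V ⊕ Bool) →₀ R) :=
  Finsupp.lmapDomain R R (List.map Sum.inl)

/-- The cone over a chain, with one of the two new vertices as apex. -/
noncomputable def suspCone (V : Type*) (b : Bool) : (List V →₀ R) →ₗ[R] (List (V ⊕ Bool) →₀ R) :=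
  Finsupp.lmapDomain R R (fun l => Sum.inr b :: l.map Sum.inl)

/-- The inverse of the cone with apex `true`; zero on the other tuples. -/
noncomputable def suspStrip (V : Type*) : (List (V ⊕ Bool) →₀ R) →ₗ[R] (List V →₀ R) :=
  Finsupp.linearCombination R fun
    | .inr true :: l => Finsupp.single (l.filterMap Sum.getLeft?) 1
    | _ => 0

/-- The cone with apex `false` on tuples that start in `X`; zero on the other tuples. -/
noncomputable def suspHomotopy (V : Type*) :
    (List (V ⊕ Bool) →₀ R) →ₗ[R] (List (V ⊕ Bool) →₀ R) :=
  Finsupp.linearCombination R fun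
    | .inr _ :: _ => 0
    | l => Finsupp.single (.inr false :: l) 1

/-- The difference of the two cones. -/
noncomputable def suspDiff (V : Type*) : (List V →₀ R) →ₗ[R] (List (V ⊕ Bool) →₀ R) :=
  suspCone R V true - suspCone R V false

theorem suspDiff_apply (c : List V →₀ R) :
    suspDiff R V c = suspCone R V true c - suspCone R V false c := rfl

theorem suspIncl_single (l : List V) :
    suspIncl R V (Finsupp.single l 1) = Finsupp.single (l.map .inl) 1 := by
  simp [suspIncl]

theorem suspCone_single (b : Bool) (l : List V) :
    suspCone R V b (Finsupp.single l 1) = Finsupp.single (.inr b :: l.map .inl) 1 := by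
  simp [suspCone]

theorem suspStrip_suspIncl (c : List V →₀ R) : suspStrip R V (suspIncl R V c) = 0 := by
  have : suspStrip R V ∘ₗ suspIncl R V = 0 := by
    ext l : 2
    cases l <;> simp [suspStrip, suspIncl_single]
  exact LinearMap.congr_fun this c

theorem suspStrip_suspCone_true (c : List V →₀ R) :
    suspStrip R V (suspCone R V true c) = c := by
  have : suspStrip R V ∘ₗ suspCone R V true = LinearMap.id := by
    ext l : 2
    simp only [LinearMap.comp_apply, Finsupp.lsingle_apply, suspCone_single, suspStrip,
      Finsupp.linearCombination_single, one_smul, List.filterMap_map, LinearMap.id_apply]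
    exact congrArg (Finsupp.single · 1) List.filterMap_some
  exact LinearMap.congr_fun this c

theorem suspStrip_suspCone_false (c : List V →₀ R) :
    suspStrip R V (suspCone R V false c) = 0 := by
  have : suspStrip R V ∘ₗ suspCone R V false = 0 := by
    ext l : 2
    simp [suspStrip, suspCone_single]
  exact LinearMap.congr_fun this c

theorem suspHomotopy_suspIncl (c : List V →₀ R) :
    suspHomotopy R V (suspIncl R V c) = suspCone R V false c := by
  have : suspHomotopy R V ∘ₗ suspIncl R V = suspCone R V false := by
    ext l : 2
    cases l <;> simp [suspHomotopy, suspIncl_single, suspCone_single]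
  exact LinearMap.congr_fun this c

theorem suspHomotopy_suspCone (b : Bool) (c : List V →₀ R) :
    suspHomotopy R V (suspCone R V b c) = 0 := by
  have : suspHomotopy R V ∘ₗ suspCone R V b = 0 := by
    ext l : 2
    simp [suspHomotopy, suspCone_single]
  exact LinearMap.congr_fun this c

theorem augNormalize_suspIncl (c : List V →₀ R) :
    augNormalize R _ (suspIncl R V c) = suspIncl R V (augNormalize R V c) := by
  have : augNormalize R _ ∘ₗ suspIncl R V = suspIncl R V ∘ₗ augNormalize R V := by
    ext l : 2
    simp only [LinearMap.comp_apply, Finsupp.lsingle_apply, suspIncl_single, augNormalize_single]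
    by_cases h : l.IsChain (· ≠ ·)
    · rw [if_pos h, if_pos (isChain_ne_map_inl.2 h), suspIncl_single]
    · rw [if_neg h, if_neg (h ∘ isChain_ne_map_inl.1), map_zero]
  exact LinearMap.congr_fun this c

theorem augNormalize_suspCone (b : Bool) (c : List V →₀ R) :
    augNormalize R _ (suspCone R V b c) = suspCone R V b (augNormalize R V c) := by
  have : augNormalize R _ ∘ₗ suspCone R V b = suspCone R V b ∘ₗ augNormalize R V := by
    ext l : 2
    simp only [LinearMap.comp_apply, Finsupp.lsingle_apply, suspCone_single, augNormalize_single]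
    by_cases h : l.IsChain (· ≠ ·)
    · rw [if_pos h, if_pos (isChain_ne_inr_cons.2 h), suspCone_single]
    · rw [if_neg h, if_neg (h ∘ isChain_ne_inr_cons.1), map_zero]
  exact LinearMap.congr_fun this c

theorem suspCone_eq (b : Bool) (c : List V →₀ R) :
    suspCone R V b c = consMap R (.inr b) (suspIncl R V c) := by
  have : suspCone R V b = consMap R (.inr b) ∘ₗ suspIncl R V := by
    ext l : 2
    simp [suspCone_single, suspIncl_single, consMap]
  exact LinearMap.congr_fun this c

theorem fullBoundary_suspIncl (c : List V →₀ R) :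
    fullBoundary R _ (suspIncl R V c) = suspIncl R V (fullBoundary R V c) :=
  (LinearMap.congr_fun (lmapDomain_fullBoundary R Sum.inl) c).symm

theorem augBoundary_suspIncl (c : List V →₀ R) :
    augBoundary R _ (suspIncl R V c) = suspIncl R V (augBoundary R V c) := by
  rw [augBoundary, LinearMap.comp_apply, fullBoundary_suspIncl, augNormalize_suspIncl]
  rfl

/-- Deleting the apex returns the base; the other faces are cones over faces of the base, with sign
reversed by the shift of index. For the empty base this needs the augmentation: the boundary of
`(b)` is the empty tuple. The normalization is the identity on filtered chains. -/
theorem augBoundary_suspCone (b : Bool) (c : List V →₀ R) :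
    augBoundary R _ (suspCone R V b c) =
      suspIncl R V (augNormalize R V c) - suspCone R V b (augBoundary R V c) := by
  rw [augBoundary, LinearMap.comp_apply, suspCone_eq, fullBoundary_consMap, map_sub,
    augNormalize_suspIncl, fullBoundary_suspIncl, ← suspCone_eq, augNormalize_suspCone]
  rfl

theorem augChainMap_suspIncl {W : Type*} (f : V → W) (c : List V →₀ R) :
    augChainMap R (Sum.map f id) (suspIncl R V c) = suspIncl R W (augChainMap R f c) := by
  have : Finsupp.lmapDomain R R (List.map (Sum.map f id)) ∘ₗ suspIncl R V =
      suspIncl R W ∘ₗ Finsupp.lmapDomain R R (List.map f) := by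
    ext l : 2
    simp [suspIncl, Finsupp.mapDomain_single]
    rfl
  have := LinearMap.congr_fun this c
  simp only [LinearMap.comp_apply] at this
  simp only [augChainMap, LinearMap.comp_apply, this, augNormalize_suspIncl]

theorem augChainMap_suspCone {W : Type*} (f : V → W) (b : Bool) (c : List V →₀ R) :
    augChainMap R (Sum.map f id) (suspCone R V b c) = suspCone R W b (augChainMap R f c) := by
  have : Finsupp.lmapDomain R R (List.map (Sum.map f id)) ∘ₗ suspCone R V b =
      suspCone R W b ∘ₗ Finsupp.lmapDomain R R (List.map f) := by
    ext l : 2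
    simp [suspCone, Finsupp.mapDomain_single]
    rfl
  have := LinearMap.congr_fun this c
  simp only [LinearMap.comp_apply] at this
  simp only [augChainMap, LinearMap.comp_apply, this, augNormalize_suspCone]

variable {R}

theorem suspCone_mem (b : Bool) {p k : ℤ} {c : List V →₀ R}
    (hc : c ∈ augFilt R X (p - 1) (k - 1)) : suspCone R V b c ∈ augFilt R (susp X) p k := by
  refine augFilt_induction (suspCone R V b) _ (fun l hl => ?_) hc
  rw [suspCone_single]
  exact Finsupp.single_mem_supported R 1 (inr_cons_mem_augGens.2 hl)

/-- As a filtered module, the augmented complex of the suspension is that of `X` plus two copies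
shifted by (1,1). The maps `suspStrip` and `suspHomotopy` are explicit on each summand. -/
theorem exists_susp_decomposition {p k : ℤ} {c : List (V ⊕ Bool) →₀ R}
    (hc : c ∈ augFilt R (susp X) p k) :
    ∃ w ∈ augFilt R X p k, ∃ s ∈ augFilt R X (p - 1) (k - 1), ∃ t ∈ augFilt R X (p - 1) (k - 1),
      c = suspIncl R V w + (suspCone R V true s + suspCone R V false t) := by
  have : c ∈ (augFilt R X p k).map (suspIncl R V) ⊔
      ((augFilt R X (p - 1) (k - 1)).map (suspCone R V true) ⊔
        (augFilt R X (p - 1) (k - 1)).map (suspCone R V false)) := by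
    refine augFilt_induction LinearMap.id _ (fun l hl => ?_) hc
    rcases mem_augGens_susp hl with ⟨m, hm, rfl⟩ | ⟨b, m, hm, rfl⟩
    · exact Submodule.mem_sup_left ⟨_, Finsupp.single_mem_supported R 1 hm, suspIncl_single R m⟩
    · refine Submodule.mem_sup_right ?_
      cases b
      · exact Submodule.mem_sup_right
          ⟨_, Finsupp.single_mem_supported R 1 hm, suspCone_single R false m⟩
      · exact Submodule.mem_sup_left
          ⟨_, Finsupp.single_mem_supported R 1 hm, suspCone_single R true m⟩
  obtain ⟨_, ⟨w, hw, rfl⟩, _, h, rfl⟩ := Submodule.mem_sup.1 this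
  obtain ⟨_, ⟨s, hs, rfl⟩, _, ⟨t, ht, rfl⟩, rfl⟩ := Submodule.mem_sup.1 h
  exact ⟨w, hw, s, hs, t, ht, rfl⟩

theorem suspStrip_mem {p k : ℤ} {c : List (V ⊕ Bool) →₀ R} (hc : c ∈ augFilt R (susp X) p k) :
    suspStrip R V c ∈ augFilt R X (p - 1) (k - 1) := by
  obtain ⟨w, hw, s, hs, t, ht, rfl⟩ := exists_susp_decomposition hc
  simpa [suspStrip_suspIncl, suspStrip_suspCone_true, suspStrip_suspCone_false] using hs

theorem suspHomotopy_mem {p k : ℤ} {c : List (V ⊕ Bool) →₀ R}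
    (hc : c ∈ augFilt R (susp X) (p - 1) (k - 1)) :
    suspHomotopy R V c ∈ augFilt R (susp X) p k := by
  obtain ⟨w, hw, s, hs, t, ht, rfl⟩ := exists_susp_decomposition hc
  simpa [suspHomotopy_suspIncl, suspHomotopy_suspCone] using suspCone_mem false hw

theorem suspDiff_mem {p k : ℤ} {c : List V →₀ R}
    (hc : c ∈ augFilt R X (p - 1) (k - 1)) : suspDiff R V c ∈ augFilt R (susp X) p k :=
  Submodule.sub_mem _ (suspCone_mem true hc) (suspCone_mem false hc)

/-- The two copies of the base cancel in the difference of the cones; only the sign from the shift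
remains. -/
theorem augBoundary_suspDiff {c : List V →₀ R} :
    augBoundary R _ (suspDiff R V c) = -suspDiff R V (augBoundary R V c) := by
  simp only [suspDiff_apply, map_sub, augBoundary_suspCone]
  abel

theorem augBoundary_suspStrip {p k : ℤ} {c : List (V ⊕ Bool) →₀ R}
    (hc : c ∈ augFilt R (susp X) p k) :
    augBoundary R V (suspStrip R V c) = -suspStrip R V (augBoundary R _ c) := by
  obtain ⟨w, hw, s, hs, t, ht, rfl⟩ := exists_susp_decomposition hc
  simp [suspStrip_suspIncl, suspStrip_suspCone_true, suspStrip_suspCone_false,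
    augBoundary_suspIncl, augBoundary_suspCone]

theorem suspStrip_suspDiff (c : List V →₀ R) : suspStrip R V (suspDiff R V c) = c := by
  simp [suspDiff_apply, suspStrip_suspCone_true, suspStrip_suspCone_false]

/-- On a chain of `X` the two terms on the left add up to the chain itself, which `suspStrip` kills.
On a cone with apex `b` only the base contributes, leaving the cone over it with apex `false` on the
left. On the right, `suspStrip` kills a cone with apex `false`, and subtracting `suspDiff` turns a
cone with apex `true` into one with apex `false`. -/
theorem suspHomotopy_spec {p k : ℤ} {c : List (V ⊕ Bool) →₀ R}
    (hc : c ∈ augFilt R (susp X) p k) :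
    augBoundary R _ (suspHomotopy R V c) + suspHomotopy R V (augBoundary R _ c) =
      c - suspDiff R V (suspStrip R V c) := by
  obtain ⟨w, hw, s, hs, t, ht, rfl⟩ := exists_susp_decomposition hc
  simp only [map_add, map_sub, suspStrip_suspIncl, suspStrip_suspCone_true,
    suspStrip_suspCone_false, augBoundary_suspIncl, augBoundary_suspCone, suspHomotopy_suspIncl,
    suspHomotopy_suspCone, suspDiff_apply, augNormalize_of_mem hw, augNormalize_of_mem hs,
    augNormalize_of_mem ht, map_zero]
  abel

/-- Naturality already holds on chains, because the induced map fixes both apexes. -/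
theorem suspStrip_augChainMap {W : Type*} (f : V → W) {p k : ℤ} {c : List (V ⊕ Bool) →₀ R}
    (hc : c ∈ augFilt R (susp X) p k) :
    suspStrip R W (augChainMap R (Sum.map f id) c) = augChainMap R f (suspStrip R V c) := by
  obtain ⟨w, hw, s, hs, t, ht, rfl⟩ := exists_susp_decomposition hc
  simp [suspStrip_suspIncl, suspStrip_suspCone_true, suspStrip_suspCone_false,
    augChainMap_suspIncl, augChainMap_suspCone]

theorem suspStrip_mem_augCycles {r p k : ℤ} {c : List (V ⊕ Bool) →₀ R}
    (hc : c ∈ augCycles R (susp X) r p k) :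
    suspStrip R V c ∈ augCycles R X r (p - 1) (k - 1) := by
  refine ⟨suspStrip_mem hc.1, ?_⟩
  rw [SetLike.mem_coe, Submodule.mem_comap, augBoundary_suspStrip hc.1, sub_right_comm]
  exact Submodule.neg_mem _ (suspStrip_mem hc.2)

theorem suspDiff_mem_augCycles {r p k : ℤ} {c : List V →₀ R}
    (hc : c ∈ augCycles R X r (p - 1) (k - 1)) :
    suspDiff R V c ∈ augCycles R (susp X) r p k := by
  refine ⟨suspDiff_mem hc.1, ?_⟩
  rw [SetLike.mem_coe, Submodule.mem_comap, augBoundary_suspDiff]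
  have h := hc.2
  rw [SetLike.mem_coe, Submodule.mem_comap, sub_right_comm] at h
  exact Submodule.neg_mem _ (suspDiff_mem h)

theorem suspStrip_mem_augBoundaries {r p k : ℤ} {c : List (V ⊕ Bool) →₀ R}
    (hc : c ∈ augBoundaries R (susp X) r p k) :
    suspStrip R V c ∈ augBoundaries R X r (p - 1) (k - 1) := by
  obtain ⟨a, ha, b, ⟨e, he, rfl⟩, rfl⟩ := Submodule.mem_sup.1 hc
  rw [map_add]
  -- The sign compensates for `suspStrip` anticommuting with the differential.
  refine Submodule.add_mem_sup (suspStrip_mem_augCycles ha) ⟨-suspStrip R V e, ?_, ?_⟩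
  · have h := suspStrip_mem_augCycles he
    rw [show p + r - 1 - 1 = p - 1 + r - 1 by ring, show k + 1 - 1 = k - 1 + 1 by ring] at h
    exact Submodule.neg_mem _ h
  · rw [map_neg, augBoundary_suspStrip he.1, neg_neg]

theorem suspDiff_mem_augBoundaries {r p k : ℤ} {c : List V →₀ R}
    (hc : c ∈ augBoundaries R X r (p - 1) (k - 1)) :
    suspDiff R V c ∈ augBoundaries R (susp X) r p k := by
  obtain ⟨a, ha, b, ⟨e, he, rfl⟩, rfl⟩ := Submodule.mem_sup.1 hc
  rw [map_add]
  refine Submodule.add_mem_sup (suspDiff_mem_augCycles ha) ⟨-suspDiff R V e, ?_, ?_⟩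
  · refine Submodule.neg_mem _ (suspDiff_mem_augCycles ?_)
    rwa [show p + r - 1 - 1 = p - 1 + r - 1 by ring, show k + 1 - 1 = k - 1 + 1 by ring]
  · rw [map_neg, augBoundary_suspDiff, neg_neg]

/-- With `h` the homotopy, the difference is `h∂c + ∂hc`. As `h` raises filtration by one and `∂c`
lies in `F_{p-2}`, the first term lies in `A^1_{p-1}` and `hc` in `A^1_{p+1}`. These are exactly the
two pieces of the denominator of page 2; on page 1 the argument would fail. -/
theorem sub_suspDiff_suspStrip_mem {p k : ℤ} {c : List (V ⊕ Bool) →₀ R}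
    (hc : c ∈ augCycles R (susp X) 2 p k) :
    c - suspDiff R V (suspStrip R V c) ∈ augBoundaries R (susp X) 2 p k := by
  obtain ⟨h1, h2⟩ := hc
  rw [SetLike.mem_coe, Submodule.mem_comap] at h2
  have hs := suspHomotopy_spec h1
  have hs' := suspHomotopy_spec h2
  rw [augBoundary_augBoundary, map_zero, add_zero] at hs'
  have e1 : suspHomotopy R V (augBoundary R _ c) ∈ augFilt R (susp X) (p - 1) k := by
    refine suspHomotopy_mem ?_
    rwa [show p - 1 - 1 = p - 2 by ring]
  rw [← hs, add_comm]
  refine Submodule.add_mem_sup ⟨e1, ?_⟩ ⟨suspHomotopy R V c, ⟨?_, ?_⟩, rfl⟩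
  -- Since `∂∂c = 0`, the homotopy formula applied to `∂c` computes `∂h∂c` without a second term.
  · rw [SetLike.mem_coe, Submodule.mem_comap, hs']
    rw [show p - 1 - (2 - 1) = p - 2 by ring]
    exact Submodule.sub_mem _ h2 (suspDiff_mem (suspStrip_mem h2))
  · refine suspHomotopy_mem ?_
    rwa [show p + 2 - 1 - 1 = p by ring, add_sub_cancel_right]
  · rw [SetLike.mem_coe, Submodule.mem_comap, eq_sub_of_add_eq hs, show p + 2 - 1 - (2 - 1) = p by ring,
      add_sub_cancel_right]
    exact Submodule.sub_mem _ (Submodule.sub_mem _ h1 (suspDiff_mem (suspStrip_mem h1)))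
      (augFilt_mono _ (by omega) _ e1)

/-- The suspension isomorphism on the second page of the augmented spectral sequence. -/
noncomputable def augSuspEquiv (R : Type*) [CommRing R] {V : Type*} (X : Digraph V) (p k : ℤ) :
    augPage R (susp X) 2 p k ≃ₗ[R] augPage R X 2 (p - 1) (k - 1) :=
  subquotientEquiv (suspStrip R V) (fun _ => suspStrip_mem_augCycles)
    (fun _ => suspStrip_mem_augBoundaries)
    (fun c hc h => by
      have := Submodule.add_mem _ (sub_suspDiff_suspStrip_mem hc) (suspDiff_mem_augBoundaries h)
      rwa [sub_add_cancel] at this)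
    (fun d hd => ⟨suspDiff R V d, suspDiff_mem_augCycles hd, by
      rw [suspStrip_suspDiff, sub_self]; exact Submodule.zero_mem _⟩)

end Suspension

/-! ### The second augmented page as reduced path homology. -/

section Reduced

variable {R : Type*} [CommRing R] {V : Type*} {X : Digraph V}

theorem filt_eq_bot_of_degree_neg (X : Digraph V) (p : ℤ) {k : ℤ} (hk : k < 0) :
    filt R X p k = ⊥ := by
  have : gensLE X p k = ∅ := by
    refine Set.eq_empty_of_forall_notMem fun l hl => hl.1.1.1 ?_
    have := hl.1.2.2
    exact List.length_eq_zero_iff.1 (by omega)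
  rw [filt, this, Finsupp.supported_empty]

theorem filt_eq_bot_of_length_neg (X : Digraph V) {p : ℤ} (k : ℤ) (hp : p < 0) :
    filt R X p k = ⊥ := by
  have : gensLE X p k = ∅ := by
    refine Set.eq_empty_of_forall_notMem ?_
    rintro l ⟨-, n, -, h⟩
    omega
  rw [filt, this, Finsupp.supported_empty]

/-- A one-vertex tuple has length 0. Hence 0-chains already lie in lower filtration when the
bidegree is `(0,l)` with `l > 0`, and give nothing on page 2 there. -/
theorem filt_degree_zero_le (X : Digraph V) (p : ℤ) {q : ℤ} (hq : 0 ≤ q) :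
    filt R X p 0 ≤ filt R X q 0 := by
  refine Finsupp.supported_mono fun l hl => ⟨hl.1, 0, ?_, hq⟩
  have h1 := hl.1.2.2
  obtain ⟨x, rfl⟩ := List.length_eq_one_iff.1 (show l.length = 1 by omega)
  rfl

theorem augFilt_eq_bot (X : Digraph V) {p : ℤ} (k : ℤ) (hp : p < -1) :
    augFilt R X p k = ⊥ := by
  have : augGens X p k = ∅ := by
    refine Set.eq_empty_of_forall_notMem ?_
    rintro l (⟨-, n, -, h⟩ | ⟨-, -, h⟩) <;> omega
  rw [augFilt, this, Finsupp.supported_empty]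

theorem augFilt_neg_one (X : Digraph V) {p : ℤ} {c : List V →₀ R}
    (hc : c ∈ augFilt R X p (-1)) : c = Finsupp.single [] (c []) := by
  refine augFilt_eqOn LinearMap.id (Finsupp.lsingle [] ∘ₗ Finsupp.lapply []) (fun l hl => ?_) hc
  rcases hl with h | ⟨rfl, -⟩
  · have h1 := h.1.2.2
    exact (h.1.1.1 (List.length_eq_zero_iff.1 (by omega))).elim
  · simp

theorem augmentation_eq_zero {p k : ℤ} {c : List V →₀ R} (hc : c ∈ filt R X p k) (hk : k ≠ 0) :
    augmentation R V c = 0 := by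
  refine augFilt_eqOn (augmentation R V) 0 (fun l hl => ?_) (filt_le_augFilt X p k hc)
  rw [augmentation_single, if_neg, LinearMap.zero_apply]
  intro h
  rcases hl with h1 | ⟨rfl, -⟩
  · have := h1.1.2.2
    omega
  · simp at h

theorem mem_augCycles {r p k : ℤ} {c : List V →₀ R} (hc : c ∈ approxCycles R X r p k)
    (h : augmentation R V c = 0) : c ∈ augCycles R X r p k := by
  refine ⟨filt_le_augFilt X p k hc.1, ?_⟩
  rw [SetLike.mem_coe, Submodule.mem_comap, augBoundary_apply, h, Finsupp.single_zero, add_zero]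
  exact filt_le_augFilt X _ _ hc.2

theorem chainMap_toPoint {p : ℤ} {c : List V →₀ R} (hc : c ∈ filt R X p 0) :
    chainMap R (toPoint X).toFun c = Finsupp.single [()] (augmentation R V c) := by
  refine augFilt_eqOn (chainMap R (toPoint X).toFun) (Finsupp.lsingle [()] ∘ₗ augmentation R V)
    (fun l hl => ?_) (filt_le_augFilt X p 0 hc)
  rcases hl with h | ⟨-, h, -⟩
  · have h1 := h.1.2.2
    obtain ⟨x, rfl⟩ := List.length_eq_one_iff.1 (show l.length = 1 by omega)
    simp [chainMap, augmentation_single, term, Nondeg, toPoint]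
  · omega

theorem gensLE_point (p k : ℤ) : gensLE point p k = {l | l = [()] ∧ k = 0 ∧ 0 ≤ p} := by
  ext l
  constructor
  · rintro ⟨⟨⟨h1, h2⟩, -, h3⟩, n, -, h4⟩
    match l with
    | [] => exact (h1 rfl).elim
    | [()] => exact ⟨rfl, by simpa using h3.symm, by omega⟩
    | () :: () :: l => exact ((List.isChain_cons_cons.1 h2).1 rfl).elim
  · rintro ⟨rfl, rfl, h⟩
    exact ⟨⟨⟨by simp, .singleton _⟩, .singleton _, by simp⟩, 0, rfl, h⟩

theorem filt_point_eq_bot (p : ℤ) {k : ℤ} (hk : k ≠ 0) : filt R point p k = ⊥ := by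
  have : gensLE point p k = ∅ := by simp [gensLE_point, hk]
  rw [filt, this, Finsupp.supported_empty]

theorem approxBoundaries_point : approxBoundaries R point 2 0 0 = ⊥ := by
  rw [approxBoundaries, approxCycles, approxCycles, filt_eq_bot_of_length_neg point 0 (by omega),
    filt_point_eq_bot _ (by omega : (0 : ℤ) + 1 ≠ 0)]
  simp

theorem subsingleton_PH_point {k l : ℤ} (h : ¬ (k = 0 ∧ l = 0)) :
    Subsingleton (PH R point k l) := by
  refine subsingleton_subquotient fun c hc => ?_
  have hc1 := hc.1
  by_cases hk : k = 0
  · subst hk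
    rcases lt_or_ge l 0 with hl | hl
    · rw [filt_eq_bot_of_length_neg point 0 hl] at hc1
      rw [(Submodule.mem_bot R).1 hc1]
      exact Submodule.zero_mem _
    · have h1 := boundary_mem_filt R hc1
      rw [filt_eq_bot_of_degree_neg point _ (by omega)] at h1
      refine Submodule.mem_sup_left ⟨filt_degree_zero_le point l (by omega) hc1, ?_⟩
      rw [SetLike.mem_coe, Submodule.mem_comap, (Submodule.mem_bot R).1 h1]
      exact Submodule.zero_mem _
  · rw [filt_point_eq_bot l hk] at hc1
    rw [(Submodule.mem_bot R).1 hc1]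
    exact Submodule.zero_mem _

/-- The path homology of the point in bidegree `(0,0)`. -/
noncomputable def PHPointEquiv (R : Type*) [CommRing R] : PH R point 0 0 ≃ₗ[R] R :=
  subquotientSingletonEquiv [()] (by
    have h : gensLE point 0 0 = {[()]} := by ext; simp [gensLE_point]
    rw [← h]
    refine le_antisymm inf_le_left fun c hc => ⟨hc, ?_⟩
    have h1 := boundary_mem_filt R hc
    rw [filt_eq_bot_of_degree_neg point _ (by omega)] at h1
    rw [SetLike.mem_coe, Submodule.mem_comap, (Submodule.mem_bot R).1 h1]
    exact Submodule.zero_mem _) approxBoundaries_point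

theorem augFilt_of_isEmpty [IsEmpty V] (X : Digraph V) (p k : ℤ) :
    augFilt R X p k = Finsupp.supported R R {l | l = [] ∧ k = -1 ∧ -1 ≤ p} := by
  have : gensLE X p k = ∅ := Set.eq_empty_of_forall_notMem fun l hl =>
    hl.1.1.1 (Subsingleton.elim _ _)
  rw [augFilt, augGens, this, Set.empty_union]

theorem augBoundary_of_isEmpty [IsEmpty V] (c : List V →₀ R) : augBoundary R V c = 0 := by
  have : augBoundary R V = 0 := by
    ext l : 2
    rw [Subsingleton.elim l []]
    exact augBoundary_nil R V
  rw [this, LinearMap.zero_apply]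

theorem subsingleton_augPage_of_isEmpty [IsEmpty V] (X : Digraph V) {p k : ℤ}
    (h : ¬ (p = -1 ∧ k = -1)) : Subsingleton (augPage R X 2 p k) := by
  refine subsingleton_subquotient fun c hc => ?_
  refine Submodule.mem_sup_left ⟨?_, ?_⟩
  · have hc1 := hc.1
    rw [augFilt_of_isEmpty] at hc1 ⊢
    refine Finsupp.supported_mono ?_ hc1
    rintro l ⟨h1, h2, h3⟩
    exact ⟨h1, h2, by omega⟩
  · rw [SetLike.mem_coe, Submodule.mem_comap, augBoundary_of_isEmpty]
    exact Submodule.zero_mem _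

/-- The augmented complex of the empty graph has homology `R` in bidegree `(-1,-1)`. -/
noncomputable def augPageIsEmptyEquiv (R : Type*) [CommRing R] [IsEmpty V] (X : Digraph V) :
    augPage R X 2 (-1) (-1) ≃ₗ[R] R :=
  subquotientSingletonEquiv [] (by
    rw [augCycles, augFilt_of_isEmpty]
    have : {l : List V | l = [] ∧ (-1 : ℤ) = -1 ∧ (-1 : ℤ) ≤ -1} = {[]} := by ext; simp
    rw [this]
    refine le_antisymm inf_le_left fun c hc => ⟨hc, ?_⟩
    rw [SetLike.mem_coe, Submodule.mem_comap, augBoundary_of_isEmpty]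
    exact Submodule.zero_mem _) (by
    rw [eq_bot_iff, augBoundaries]
    refine sup_le ?_ ?_
    · rw [augCycles, augFilt_eq_bot X _ (by omega)]
      exact inf_le_left
    · rintro _ ⟨e, -, rfl⟩
      rw [augBoundary_of_isEmpty]
      exact Submodule.zero_mem _)

/-- The augmented boundary must lie in `F_{l-2}`, and `l - 2 < -1` leaves no room even for the empty
tuple. -/
theorem augmentation_eq_zero_of_mem {l : ℤ} {c : List V →₀ R} (hl : l < 1)
    (hc : c ∈ augCycles R X 2 l 0) : augmentation R V c = 0 := by
  have h := hc.2
  rw [SetLike.mem_coe, augFilt_eq_bot X _ (by omega), Submodule.mem_comap, Submodule.mem_bot,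
    augBoundary_apply] at h
  have h1 := boundary_mem_filt R (c := forgetEmpty R V c) (forgetEmpty_mem_filt hc.1)
  rw [boundary_forgetEmpty, filt_eq_bot_of_degree_neg X _ (by omega), Submodule.mem_bot] at h1
  rw [h1, zero_add, Finsupp.single_eq_zero] at h
  exact h

/-- Injectivity of `forgetPage` on representatives. Nonemptiness enters only in degree -1, where a
vertex is needed to bound the empty tuple. -/
theorem mem_augBoundaries [Nonempty V] {k l : ℤ} {c : List V →₀ R}
    (hc : c ∈ augCycles R X 2 l k) (h : forgetEmpty R V c ∈ approxBoundaries R X 2 l k) :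
    c ∈ augBoundaries R X 2 l k := by
  by_cases hk : k = -1
  · subst hk
    rcases lt_or_ge l (-1) with hl | hl
    · have h1 := hc.1
      rw [augFilt_eq_bot X _ hl] at h1
      rw [(Submodule.mem_bot R).1 h1]
      exact Submodule.zero_mem _
    · obtain ⟨v⟩ := ‹Nonempty V›
      have h1 : augBoundary R V (Finsupp.single [v] (c [])) = c := by
        conv_rhs => rw [augFilt_neg_one X hc.1]
        rw [← mul_one (c []), ← smul_eq_mul, ← Finsupp.smul_single, map_smul, augBoundary_apply,
          augmentation_single]
        simp [boundary, term, Nondeg]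
      refine Submodule.mem_sup_right ⟨_, ⟨?_, ?_⟩, h1⟩
      · refine filt_le_augFilt X _ _ (Finsupp.single_mem_supported R _ ⟨⟨⟨by simp, by simp⟩,
          by simp, by simp⟩, 0, rfl, by push_cast; omega⟩)
      · rw [SetLike.mem_coe, Submodule.mem_comap, h1, show l + 2 - 1 - (2 - 1) = l by ring]
        exact hc.1
  · have hf := hc.1
    rw [augFilt_eq_filt X l hk] at hf
    rw [forgetEmpty_of_mem hf] at h
    obtain ⟨a, ha, b, ⟨e, he, rfl⟩, rfl⟩ := Submodule.mem_sup.1 h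
    -- The chain `e` has degree `k + 1 ≠ 0`, so its two boundaries agree.
    have he0 := augmentation_eq_zero he.1 (by omega)
    refine Submodule.add_mem_sup ?_ ⟨e, mem_augCycles he he0, by
      rw [augBoundary_apply, he0, Finsupp.single_zero, add_zero]⟩
    by_cases hk0 : k = 0
    · subst hk0
      rcases lt_or_ge l 1 with hl | hl
      · have h1 := ha.1
        rw [filt_eq_bot_of_length_neg X _ (by omega)] at h1
        rw [(Submodule.mem_bot R).1 h1]
        exact Submodule.zero_mem _
      -- The augmentation of `a` may be nonzero here, but `F_{l-2}` contains the empty tuple because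
      -- `l ≥ 1`.
      · refine ⟨filt_le_augFilt X _ _ ha.1, ?_⟩
        rw [SetLike.mem_coe, Submodule.mem_comap, augBoundary_apply]
        exact Submodule.add_mem _ (filt_le_augFilt X _ _ ha.2)
          (Finsupp.single_mem_supported R _ (Or.inr ⟨rfl, by omega, by omega⟩))
    · exact mem_augCycles ha (augmentation_eq_zero ha.1 hk0)

/-- Forgetting the empty tuple, on the second page. -/
noncomputable def forgetPage (R : Type*) [CommRing R] (X : Digraph V) (k l : ℤ) :
    augPage R X 2 l k →ₗ[R] PH R X k l :=
  Submodule.mapQ _ _ ((forgetEmpty R V).restrict fun _ hc => forgetEmpty_mem_approxCycles hc)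
    fun _ hc => forgetEmpty_mem_approxBoundaries hc

theorem forgetPage_mk (k l : ℤ) (c : augCycles R X 2 l k) :
    forgetPage R X k l (Submodule.Quotient.mk c) =
      Submodule.Quotient.mk ⟨forgetEmpty R V c, forgetEmpty_mem_approxCycles c.2⟩ := rfl

theorem forgetPage_injective [Nonempty V] (k l : ℤ) :
    Function.Injective (forgetPage R X k l) := by
  rw [injective_iff_map_eq_zero]
  intro z hz
  obtain ⟨c, rfl⟩ := Submodule.Quotient.mk_surjective _ z
  exact (Submodule.Quotient.mk_eq_zero _).2 (mem_augBoundaries c.2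
    ((Submodule.Quotient.mk_eq_zero ((approxBoundaries R X 2 l k).submoduleOf _)).1 hz))

/-- On 0-chains the map to the point is the augmentation, and in bidegree (0,0) nothing is divided
out for the point. -/
theorem PHmap_toPoint_eq_zero_iff (c : approxCycles R X 2 0 0) :
    PHmap R (toPoint X) 0 0 (Submodule.Quotient.mk c) = 0 ↔ augmentation R V c = 0 := by
  refine (Submodule.Quotient.mk_eq_zero
    ((approxBoundaries R point 2 0 0).submoduleOf (approxCycles R point 2 0 0))).trans ?_
  change chainMap R (toPoint X).toFun c ∈ approxBoundaries R point 2 0 0 ↔ _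
  rw [approxBoundaries_point, Submodule.mem_bot, chainMap_toPoint c.2.1, Finsupp.single_eq_zero]

theorem forgetPage_mem_redPH (k l : ℤ) (z : augPage R X 2 l k) :
    forgetPage R X k l z ∈ redPH R X k l := by
  change PHmap R (toPoint X) k l _ = 0
  by_cases h : k = 0 ∧ l = 0
  · obtain ⟨rfl, rfl⟩ := h
    obtain ⟨c, rfl⟩ := Submodule.Quotient.mk_surjective _ z
    have hc := c.2.1
    rw [augFilt_eq_filt X _ (by omega)] at hc
    rw [forgetPage_mk, PHmap_toPoint_eq_zero_iff]
    change augmentation R V (forgetEmpty R V c) = 0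
    rw [forgetEmpty_of_mem hc]
    exact augmentation_eq_zero_of_mem (by omega) c.2
  · have := subsingleton_PH_point (R := R) h
    exact Subsingleton.elim _ _

theorem exists_forgetPage_eq {k l : ℤ} {z : PH R X k l} (hz : z ∈ redPH R X k l) :
    ∃ y, forgetPage R X k l y = z := by
  obtain ⟨c, rfl⟩ := Submodule.Quotient.mk_surjective _ z
  by_cases h : augmentation R V c = 0
  · refine ⟨Submodule.Quotient.mk ⟨c, mem_augCycles c.2 h⟩, ?_⟩
    rw [forgetPage_mk]
    exact congrArg _ (Subtype.ext (forgetEmpty_of_mem c.2.1))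
  -- A nonzero augmentation forces degree 0. Then `l < 0` leaves no chains, `l = 0` contradicts
  -- `hz`, and for `l > 0` the class is zero because 0-chains have length 0.
  · have hk : k = 0 := by
      by_contra hk
      exact h (augmentation_eq_zero c.2.1 hk)
    subst hk
    refine ⟨0, ?_⟩
    rw [map_zero, eq_comm, Submodule.Quotient.mk_eq_zero]
    rcases lt_trichotomy l 0 with hl | rfl | hl
    · have h1 := c.2.1
      rw [filt_eq_bot_of_length_neg X _ hl, SetLike.mem_coe, Submodule.mem_bot] at h1
      rw [h1, map_zero] at h
      exact (h rfl).elim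
    · exact (h ((PHmap_toPoint_eq_zero_iff c).1 hz)).elim
    · have h1 := boundary_mem_filt R c.2.1
      rw [filt_eq_bot_of_degree_neg X _ (by omega)] at h1
      refine Submodule.mem_sup_left ⟨filt_degree_zero_le X l (by omega) c.2.1, ?_⟩
      rw [SetLike.mem_coe, Submodule.mem_comap]
      refine Eq.subst (motive := (· ∈ filt R X _ _)) ((Submodule.mem_bot R).1 h1).symm
        (Submodule.zero_mem _)

/-- For a nonempty graph, the second page of the augmented spectral sequence is the reduced path
homology. -/
noncomputable def augPageEquiv (R : Type*) [CommRing R] [Nonempty V] (X : Digraph V) (k l : ℤ) :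
    augPage R X 2 l k ≃ₗ[R] redPH R X k l :=
  LinearEquiv.ofBijective ((forgetPage R X k l).codRestrict _ (forgetPage_mem_redPH k l))
    ⟨fun _ _ h => forgetPage_injective k l (congrArg Subtype.val h), fun z => by
      obtain ⟨y, hy⟩ := exists_forgetPage_eq z.2
      exact ⟨y, Subtype.ext hy⟩⟩

/-- The suspension isomorphism for reduced path homology. -/
noncomputable def suspEquiv (R : Type*) [CommRing R] [Nonempty V] (X : Digraph V) (k l : ℤ) :
    redPH R (susp X) k l ≃ₗ[R] redPH R X (k - 1) (l - 1) :=
  (augPageEquiv R (susp X) k l).symm.trans <|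
    (augSuspEquiv R X l k).trans (augPageEquiv R X (k - 1) (l - 1))

theorem suspEquiv_naturality {W : Type*} [Nonempty V] [Nonempty W] {Y : Digraph W}
    (f : DigraphMap X Y) (k l : ℤ) (z : redPH R (susp X) k l) :
    suspEquiv R Y k l (redPHmap R (suspMap f) k l z) =
      redPHmap R f (k - 1) (l - 1) (suspEquiv R X k l z) := by
  obtain ⟨y, rfl⟩ := (augPageEquiv R (susp X) k l).surjective z
  obtain ⟨c, rfl⟩ := Submodule.Quotient.mk_surjective _ y
  have h : redPHmap R (suspMap f) k l (augPageEquiv R (susp X) k l (Submodule.Quotient.mk c)) =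
      augPageEquiv R (susp Y) k l (Submodule.Quotient.mk
        ⟨augChainMap R (suspMap f).toFun c, augChainMap_mem_augCycles (suspMap f) c.2⟩) := by
    refine Subtype.ext (congrArg (Submodule.Quotient.mk
      (p := (approxBoundaries R (susp Y) 2 l k).submoduleOf _)) (Subtype.ext ?_))
    exact chainMap_forgetEmpty R (suspMap f).toFun c
  rw [h]
  simp only [suspEquiv, LinearEquiv.trans_apply, LinearEquiv.symm_apply_apply]
  refine Subtype.ext (congrArg (Submodule.Quotient.mk
      (p := (approxBoundaries R Y 2 (l - 1) (k - 1)).submoduleOf _)) (Subtype.ext ?_))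
  change forgetEmpty R W (suspStrip R W (augChainMap R (Sum.map f.toFun id) c)) =
    chainMap R f.toFun (forgetEmpty R V (suspStrip R V c))
  rw [suspStrip_augChainMap f.toFun c.2.1, chainMap_forgetEmpty]

theorem redPH_eq_top (X : Digraph V) {k l : ℤ} (h : ¬ (k = 0 ∧ l = 0)) :
    redPH R X k l = ⊤ := by
  have := subsingleton_PH_point (R := R) h
  exact eq_top_iff.2 fun z _ => Subsingleton.elim (α := PH R point k l) _ _

/-- Away from bidegree `(0,0)` the reduced and the unreduced groups agree. -/
noncomputable def redPHEquiv (R : Type*) [CommRing R] (X : Digraph V) {k l : ℤ}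
    (h : ¬ (k = 0 ∧ l = 0)) : redPH R X k l ≃ₗ[R] PH R X k l :=
  LinearEquiv.ofTop _ (redPH_eq_top X h)

/-- The inclusion of a vertex. -/
def ofPoint (X : Digraph V) (v : V) : DigraphMap point X where
  toFun := fun _ => v
  map_adj := fun h => h.elim

/-- The path homology of a nonempty graph is the sum of its reduced path homology and that of the
point. -/
theorem nonempty_PH_equiv_prod [Nonempty V] (X : Digraph V) :
    Nonempty (PH R X 0 0 ≃ₗ[R] redPH R X 0 0 × R) := by
  obtain ⟨v⟩ := ‹Nonempty V›
  -- A vertex gives a section of the map to the point, so the kernel splits off.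
  have hs : ∀ z, PHmap R (toPoint X) 0 0 (PHmap R (ofPoint X v) 0 0 z) = z := fun z => by
    rw [← PHmap_comp]
    exact PHmap_id R point 0 0 z
  suffices e : PH R X 0 0 ≃ₗ[R] redPH R X 0 0 × PH R point 0 0 from
    ⟨e.trans ((LinearEquiv.refl R _).prodCongr (PHPointEquiv R))⟩
  refine LinearEquiv.ofBijective (LinearMap.prod
    (LinearMap.codRestrict _ (LinearMap.id - PHmap R (ofPoint X v) 0 0 ∘ₗ PHmap R (toPoint X) 0 0)
      fun z => ?_) (PHmap R (toPoint X) 0 0)) ⟨?_, ?_⟩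
  · change PHmap R (toPoint X) 0 0 (z - PHmap R (ofPoint X v) 0 0 (PHmap R (toPoint X) 0 0 z)) = 0
    rw [map_sub, hs, sub_self]
  · rw [injective_iff_map_eq_zero]
    intro z hz
    have h1 : z - PHmap R (ofPoint X v) 0 0 (PHmap R (toPoint X) 0 0 z) = 0 :=
      congrArg Subtype.val (congrArg Prod.fst hz)
    have h2 : PHmap R (toPoint X) 0 0 z = 0 := congrArg Prod.snd hz
    rwa [h2, map_zero, sub_zero] at h1
  · rintro ⟨⟨y, hy⟩, w⟩
    have hy' : PHmap R (toPoint X) 0 0 y = 0 := hy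
    have h2 : PHmap R (toPoint X) 0 0 (y + PHmap R (ofPoint X v) 0 0 w) = w := by
      rw [map_add, hs, hy', zero_add]
    refine ⟨y + PHmap R (ofPoint X v) 0 0 w, Prod.ext (Subtype.ext ?_) h2⟩
    change y + PHmap R (ofPoint X v) 0 0 w -
      PHmap R (ofPoint X v) 0 0 (PHmap R (toPoint X) 0 0 (y + PHmap R (ofPoint X v) 0 0 w)) = y
    rw [h2, add_sub_cancel_right]

end Reduced

/-! ### Spheres as iterated suspensions of the empty graph. -/

section Spheres

variable (R : Type*) [CommRing R]

/-- The augmented pages are used because `augSuspEquiv` also covers the empty graph, for which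
`augPageEquiv` is unavailable. Keeping `p'` and `k'` as variables avoids transporting modules along
equalities of integers. -/
theorem nonempty_augPage_iterSusp_equiv (n : ℕ) {p k p' k' : ℤ} (hp : p' = p - n)
    (hk : k' = k - n) :
    Nonempty (augPage R (iterSusp n) 2 p k ≃ₗ[R] augPage R (iterSusp 0) 2 p' k') := by
  induction n generalizing p k with
  | zero =>
    obtain rfl : p' = p := by simpa using hp
    obtain rfl : k' = k := by simpa using hk
    exact ⟨LinearEquiv.refl R _⟩
  | succ n ih =>
    obtain ⟨e⟩ := ih (p := p - 1) (k := k - 1) (by push_cast at hp; omega)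
      (by push_cast at hk; omega)
    exact ⟨(augSuspEquiv R (iterSusp n) p k).trans e⟩

instance isEmpty_iterVert_zero : IsEmpty (IterVert 0) := inferInstanceAs (IsEmpty Empty)

instance nonempty_iterVert_succ (n : ℕ) : Nonempty (IterVert (n + 1)) :=
  inferInstanceAs (Nonempty (IterVert n ⊕ Bool))

theorem nonempty_redPH_sphere_equiv (n : ℕ) : Nonempty (redPH R (sphere n) n n ≃ₗ[R] R) := by
  obtain ⟨e⟩ := nonempty_augPage_iterSusp_equiv R (n + 1) (p := n) (k := n) (p' := -1) (k' := -1)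
    (by push_cast; ring) (by push_cast; ring)
  exact ⟨(augPageEquiv R (sphere n) n n).symm.trans (e.trans (augPageIsEmptyEquiv R _))⟩

theorem subsingleton_redPH_sphere (n : ℕ) {k l : ℤ} (h : ¬ (k = n ∧ l = n)) :
    Subsingleton (redPH R (sphere n) k l) := by
  obtain ⟨e⟩ := nonempty_augPage_iterSusp_equiv R (n + 1) (p := l) (k := k) rfl rfl
  have := subsingleton_augPage_of_isEmpty (R := R) (iterSusp 0)
    (p := l - (n + 1 : ℕ)) (k := k - (n + 1 : ℕ)) (by push_cast; omega)
  exact ((augPageEquiv R (sphere n) k l).symm.trans e).toEquiv.subsingleton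

end Spheres

end MagPath

/-! ### Assembly of the statements about suspensions and spheres. -/

theorem mainTheorem12 (R : Type v) [CommRing R] :
    -- The suspension isomorphism of reduced groups, natural in nonempty directed graphs.
    (∀ k l : ℤ, 0 ≤ k → 0 ≤ l →
      ∃ φ : ∀ {V : Type u} [Nonempty V] (X : Digraph V),
          MagPath.redPH R (MagPath.susp X) k l ≃ₗ[R] MagPath.redPH R X (k - 1) (l - 1),
        ∀ {V W : Type u} [Nonempty V] [Nonempty W] {X : Digraph V} {Y : Digraph W}
          (f : MagPath.DigraphMap X Y) (z : MagPath.redPH R (MagPath.susp X) k l),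
          φ Y (MagPath.redPHmap R (MagPath.suspMap f) k l z) =
            MagPath.redPHmap R f (k - 1) (l - 1) (φ X z)) ∧
    -- Outside the bidegrees (0,0) and (1,1), the same for the unreduced groups.
    (∀ k l : ℤ, 0 ≤ k → 0 ≤ l → ¬ (k = 0 ∧ l = 0) → ¬ (k = 1 ∧ l = 1) →
      ∃ ψ : ∀ {V : Type u} [Nonempty V] (X : Digraph V),
          MagPath.PH R (MagPath.susp X) k l ≃ₗ[R] MagPath.PH R X (k - 1) (l - 1),
        ∀ {V W : Type u} [Nonempty V] [Nonempty W] {X : Digraph V} {Y : Digraph W}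
          (f : MagPath.DigraphMap X Y) (z : MagPath.PH R (MagPath.susp X) k l),
          ψ Y (MagPath.PHmap R (MagPath.suspMap f) k l z) =
            MagPath.PHmap R f (k - 1) (l - 1) (ψ X z)) ∧
    -- In those two bidegrees, the unreduced groups differ by a single summand `R`.
    (∀ {V : Type u} [Nonempty V] (X : Digraph V),
      Nonempty (MagPath.PH R (MagPath.susp X) 0 0 ≃ₗ[R] MagPath.PH R X (-1) (-1) × R) ∧
      Nonempty (MagPath.PH R X 0 0 ≃ₗ[R] MagPath.PH R (MagPath.susp X) 1 1 × R)) ∧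
    -- The reduced groups of the spheres: `R` in bidegree (n,n) only.
    (∀ (n : ℕ) (k l : ℤ),
      (k = n ∧ l = n → Nonempty (MagPath.redPH R (MagPath.sphere n) k l ≃ₗ[R] R)) ∧
      (¬ (k = n ∧ l = n) → Subsingleton (MagPath.redPH R (MagPath.sphere n) k l))) ∧
    -- The unreduced groups of `𝕊⁰`: `R ⊕ R` in bidegree (0,0) only.
    (∀ k l : ℤ,
      (k = 0 ∧ l = 0 → Nonempty (MagPath.PH R (MagPath.sphere 0) k l ≃ₗ[R] R × R)) ∧
      (¬ (k = 0 ∧ l = 0) → Subsingleton (MagPath.PH R (MagPath.sphere 0) k l))) ∧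
    -- The unreduced groups of `𝕊ⁿ` for `n > 0`: `R` in bidegrees (0,0) and (n,n) only.
    (∀ n : ℕ, 0 < n → ∀ k l : ℤ,
      ((k = 0 ∧ l = 0) ∨ (k = n ∧ l = n) →
        Nonempty (MagPath.PH R (MagPath.sphere n) k l ≃ₗ[R] R)) ∧
      (¬ ((k = 0 ∧ l = 0) ∨ (k = n ∧ l = n)) →
        Subsingleton (MagPath.PH R (MagPath.sphere n) k l))) := by
  refine ⟨fun k l _ _ => ⟨fun X => MagPath.suspEquiv R X k l, fun f z =>
      MagPath.suspEquiv_naturality f k l z⟩, fun k l _ _ h0 h1 => ?_, fun {V} _ X => ⟨?_, ?_⟩,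
    fun n k l => ⟨?_, MagPath.subsingleton_redPH_sphere R n⟩, fun k l => ⟨?_, fun h => ?_⟩,
    fun n hn k l => ⟨?_, fun h => ?_⟩⟩
  -- Excluding (0,0) and (1,1) keeps both bidegrees away from (0,0), so both reduced groups are the
  -- full groups.
  · have h2 : ¬ (k - 1 = 0 ∧ l - 1 = 0) := by omega
    refine ⟨fun X => (MagPath.redPHEquiv R (MagPath.susp X) h0).symm.trans
      ((MagPath.suspEquiv R X k l).trans (MagPath.redPHEquiv R X h2)), fun {V W} _ _ {X Y} f z => ?_⟩
    obtain ⟨y, rfl⟩ := (MagPath.redPHEquiv R (MagPath.susp X) h0).surjective z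
    have h : MagPath.PHmap R (MagPath.suspMap f) k l (MagPath.redPHEquiv R (MagPath.susp X) h0 y) =
        MagPath.redPHEquiv R (MagPath.susp Y) h0
          (MagPath.redPHmap R (MagPath.suspMap f) k l y) := rfl
    rw [h]
    simp only [LinearEquiv.trans_apply, LinearEquiv.symm_apply_apply]
    rw [MagPath.suspEquiv_naturality]
    rfl
  · obtain ⟨e⟩ := MagPath.nonempty_PH_equiv_prod (R := R) (MagPath.susp X)
    exact ⟨e.trans (((MagPath.suspEquiv R X 0 0).trans
      (MagPath.redPHEquiv R X (by omega))).prodCongr (LinearEquiv.refl R R))⟩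
  · obtain ⟨e⟩ := MagPath.nonempty_PH_equiv_prod (R := R) X
    exact ⟨e.trans (((MagPath.suspEquiv R X 1 1).symm.trans
      (MagPath.redPHEquiv R (MagPath.susp X) (by omega))).prodCongr (LinearEquiv.refl R R))⟩
  · rintro ⟨rfl, rfl⟩
    exact MagPath.nonempty_redPH_sphere_equiv R n
  · rintro ⟨rfl, rfl⟩
    obtain ⟨e⟩ := MagPath.nonempty_PH_equiv_prod (R := R) (MagPath.sphere 0)
    obtain ⟨e'⟩ := MagPath.nonempty_redPH_sphere_equiv R 0
    exact ⟨e.trans (e'.prodCongr (LinearEquiv.refl R R))⟩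
  · have := MagPath.subsingleton_redPH_sphere R 0 (k := k) (l := l) (by exact_mod_cast h)
    exact (MagPath.redPHEquiv R (MagPath.sphere 0) h).symm.toEquiv.subsingleton
  · rintro (⟨rfl, rfl⟩ | ⟨rfl, rfl⟩)
    · obtain ⟨e⟩ := MagPath.nonempty_PH_equiv_prod (R := R) (MagPath.sphere n)
      have := MagPath.subsingleton_redPH_sphere R n (k := 0) (l := 0) (by omega)
      -- For `n > 0` the reduced group vanishes in bidegree (0,0), so only the summand `R` from the
      -- point survives.
      have : Unique (MagPath.redPH R (MagPath.sphere n) 0 0) := Unique.mk' _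
      exact ⟨e.trans LinearEquiv.uniqueProd⟩
    · obtain ⟨e⟩ := MagPath.nonempty_redPH_sphere_equiv R n
      exact ⟨(MagPath.redPHEquiv R (MagPath.sphere n) (by omega)).symm.trans e⟩
  · have := MagPath.subsingleton_redPH_sphere R n (k := k) (l := l) (by omega)
    exact (MagPath.redPHEquiv R (MagPath.sphere n) (by omega)).symm.toEquiv.subsingleton
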